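/- Let $N\ge 0$ be an integer and $\mathcal H=L^2(\mathbb R^N)$ (complex-valued, Lebesgue measure), let $\mathcal S(\mathbb R^N)\subset\mathcal H$ be the space of Schwartz functions, and on $\mathcal S(\mathbb R^N)$ let $(Q_i\varphi)(q)=q_i\varphi(q)$, $P_i\varphi=-i\,\partial\varphi/\partial q_i$, $Q^\alpha=Q_1^{\alpha_1}\cdots Q_N^{\alpha_N}$ and $P^\beta=P_1^{\beta_1}\cdots P_N^{\beta_N}$ for multi-indices $\alpha,\beta\in\mathbb N_0^N$. A bounded operator $T$ on $\mathcal H$ is called a Schwartz operator if for all multi-indices $\alpha,\alpha',\beta,\beta'$ $$\sup\bigl\{\,|\langle P^\beta Q^\alpha\psi,\;T P^{\beta'}Q^{\alpha'}\varphi\rangle| \;:\; \psi,\varphi\in\mathcal S(\mathbb R^N),\ \|\psi\|\le 1,\ \|\varphi\|\le 1\,\bigr\}<\infty .$$ (1) If $T$ is a positive Schwartz operator, then its positive square root $\sqrt T$ is a Schwartz operator. (2) If $T$ is a Schwartz operator, then $|T|=\sqrt{T^*T}$ is a Schwartz operator. Moreover $T$ is compact (so that every eigenvalue $c>0$ of $|T|$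 has finite multiplicity), and the singular values $(c_k)$ of $T$, i.e. the nonzero eigenvalues of $|T|$ repeated according to multiplicity, satisfy $$\sum_k c_k^{\frac1{2n}}<\infty\qquad\text{for all integers } n\ge 1 .$$ -/

import Mathlib

open MeasureTheory
open scoped SchwartzMap LineDeriv

noncomputable section

/-- The configuration space `ℝ^N` with its Euclidean structure. -/
abbrev Config (N : ℕ) : Type := EuclideanSpace ℝ (Fin N)

/-- The position Hilbert space `L²(ℝ^N; ℂ)` with respect to Lebesgue measure. -/
abbrev PosHilbert (N : ℕ) : Type := Lp ℂ 2 (volume : Measure (Config N))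

/-- The class in `L²(ℝ^N)` of a Schwartz function. -/
def schwartzVec {N : ℕ} (φ : 𝓢(Config N, ℂ)) : PosHilbert N := φ.toLp 2 volume

/-- The position operator `Q_i` on Schwartz functions: multiplication by the coordinate `q_i`. -/
def posOp {N : ℕ} (i : Fin N) : 𝓢(Config N, ℂ) →L[ℂ] 𝓢(Config N, ℂ) :=
  SchwartzMap.smulLeftCLM ℂ (fun q : Config N => ((q i : ℝ) : ℂ))

/-- The momentum operator `P_i = -i ∂/∂q_i` on Schwartz functions. -/
def momOp {N : ℕ} (i : Fin N) : 𝓢(Config N, ℂ) →L[ℂ] 𝓢(Config N, ℂ) :=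
  (-Complex.I) • LineDeriv.lineDerivOpCLM ℂ 𝓢(Config N, ℂ) (EuclideanSpace.single i (1 : ℝ))

theorem posOp_apply {N : ℕ} (i : Fin N) (φ : 𝓢(Config N, ℂ)) (q : Config N) :
    posOp i φ q = ((q i : ℝ) : ℂ) * φ q := by
  have h : (fun q : Config N => ((q i : ℝ) : ℂ)).HasTemperateGrowth :=
    (Complex.ofRealCLM ∘L (EuclideanSpace.proj i : Config N →L[ℝ] ℝ)).hasTemperateGrowth
  rw [posOp, SchwartzMap.smulLeftCLM_apply_apply h, smul_eq_mul]

theorem momOp_apply {N : ℕ} (i : Fin N) (φ : 𝓢(Config N, ℂ)) (q : Config N) :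
    momOp i φ q = -Complex.I * fderiv ℝ φ q (EuclideanSpace.single i (1 : ℝ)) := by
  simp [momOp, SchwartzMap.lineDerivOp_apply_eq_fderiv]

/-- `Q^α = Q_1^{α_1} ⋯ Q_N^{α_N}` for a multi-index `α`. -/
def posPow {N : ℕ} (α : Fin N → ℕ) : 𝓢(Config N, ℂ) →L[ℂ] 𝓢(Config N, ℂ) :=
  (List.ofFn fun i => posOp i ^ α i).prod

/-- `P^β = P_1^{β_1} ⋯ P_N^{β_N}` for a multi-index `β`. -/
def momPow {N : ℕ} (β : Fin N → ℕ) : 𝓢(Config N, ℂ) →L[ℂ] 𝓢(Config N, ℂ) :=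
  (List.ofFn fun i => momOp i ^ β i).prod

/-- `T ∈ B(L²(ℝ^N))` is a Schwartz operator if for all multi-indices `α, α', β, β'` the form
`(ψ, φ) ↦ ⟨P^β Q^α ψ, T P^β' Q^α' φ⟩` on Schwartz functions is bounded with respect to the
`L²`-norm, i.e. its absolute values on the `L²`-unit ball have a finite supremum. -/
def IsSchwartzOperator {N : ℕ} (T : PosHilbert N →L[ℂ] PosHilbert N) : Prop :=
  ∀ α α' β β' : Fin N → ℕ,
    BddAbove {r : ℝ | ∃ ψ φ : 𝓢(Config N, ℂ), ‖schwartzVec ψ‖ ≤ 1 ∧ ‖schwartzVec φ‖ ≤ 1 ∧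
      r = ‖inner ℂ (schwartzVec (momPow β (posPow α ψ)))
        (T (schwartzVec (momPow β' (posPow α' φ))))‖}

section HilbertSpaceOperators

variable {H : Type*} [NormedAddCommGroup H] [InnerProductSpace ℂ H] [CompleteSpace H]

/-- The positive square root `√T` of a positive operator `T`. -/
def opSqrt (T : H →L[ℂ] H) : H →L[ℂ] H := CFC.sqrt T

/-- The absolute value `|T| = √(T* T)`. -/
def opAbs (T : H →L[ℂ] H) : H →L[ℂ] H := opSqrt (T.adjoint * T)

/-- `√T` is the positive operator with square `T`. -/
theorem opSqrt_spec {T : H →L[ℂ] H} (hT : T.IsPositive) :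
    (opSqrt T).IsPositive ∧ opSqrt T * opSqrt T = T := by
  have h : (0 : H →L[ℂ] H) ≤ T := (ContinuousLinearMap.nonneg_iff_isPositive T).2 hT
  exact ⟨(ContinuousLinearMap.nonneg_iff_isPositive _).1 (CFC.sqrt_nonneg T),
    CFC.sqrt_mul_sqrt_self T h⟩

/-- The eigenspace of `|T|` for the real number `c`. -/
def absEigenspace (T : H →L[ℂ] H) (c : ℝ) : Submodule ℂ H :=
  Module.End.eigenspace (opAbs T : H →ₗ[ℂ] H) (c : ℂ)

/-- Index set of the singular values of a compact operator `T`: each number `c > 0` occurs as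
often as its multiplicity as an eigenvalue of `|T|` (finite, since `|T|` is compact; it is zero
when `c` is not an eigenvalue). -/
def SingularIndex (T : H →L[ℂ] H) : Type :=
  Σ c : {c : ℝ // 0 < c}, Fin (Module.finrank ℂ (absEigenspace T c))

/-- The singular values `c_k ≠ 0` of a compact operator `T`, i.e. the nonzero eigenvalues of
`|T|`, repeated according to multiplicity. -/
def singularValue (T : H →L[ℂ] H) (k : SingularIndex T) : ℝ :=
  (k.1 : ℝ)

end HilbertSpaceOperators

end

open scoped FourierTransform ContDiff

/-! Normal ordering shows that T is a Schwartz operator exactly when ⟨Aψ, T Bφ⟩ is L²-bounded for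
all A, B in the algebra generated by positions and momenta (`isSchwartzOperator_iff`). This algebra
is closed under formal adjoints and under conjugation by the Fourier transform.

Square roots: put S = √T. Since ‖S Aφ‖² = ⟨Aφ, T Aφ⟩, every S A is bounded. Hence S maps L² into the
common domain of the adjoints of all A, and that domain consists of Schwartz functions
(`exists_schwartzVec_eq`). So A†SB makes sense as a map on Schwartz functions, and it must be shown
bounded (`RightBounded.formBounded`). Let X = A†SB and Y = X†X. In Yⁿ⁺¹ the factors regroup as B†S ·
Zⁿ · AA†SB with Z = AA†S BB†S bounded, so ‖Yⁿ⁺¹φ‖ ≤ K(φ) Mⁿ with M independent of φ. Because Y is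
symmetric, ‖Yⁿφ‖ is log-convex in n, and the growth rate M then bounds already the first step: ‖Yφ‖
≤ M‖φ‖. Thus ‖Xφ‖² = ⟨φ, Yφ⟩ ≤ M‖φ‖². The statement on |T| follows because T*T is again Schwartz.

Singular values: with w = (1+|q|²)^(-(N+1)), boundedness of T on the algebra gives ‖Tψ‖ ≤ C‖w 𝓕 w
ψ‖, and w 𝓕 w has a square-integrable kernel. Every Schwartz operator is therefore Hilbert–Schmidt,
hence compact. Iterated roots |T|^(2^-m) are Schwartz, so ∑ c_k^(2·2^-m) < ∞ for every m, which
covers all positive exponents. -/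

/-! ### Normal ordering in an abstract algebra. -/

theorem exists_mul_prod_ofFn_pow {M : Type*} [Monoid M] :
    ∀ {n : ℕ} (g : Fin n → M), (∀ i j, Commute (g i) (g j)) → ∀ (j : Fin n) (α : Fin n → ℕ),
      ∃ α' : Fin n → ℕ, g j * (List.ofFn fun i => g i ^ α i).prod =
        (List.ofFn fun i => g i ^ α' i).prod := by
  intro n
  induction n with
  | zero => intro g _ j; exact j.elim0
  | succ n ih =>
    intro g hg j α
    refine Fin.cases ?_ (fun i => ?_) j
    · refine ⟨Fin.cons (α 0 + 1) fun i => α i.succ, ?_⟩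
      simp [List.ofFn_succ, pow_succ', mul_assoc]
    · obtain ⟨α', h⟩ := ih (fun i => g i.succ) (fun i j => hg _ _) i (fun i => α i.succ)
      refine ⟨Fin.cons (α 0) α', ?_⟩
      simp only [List.ofFn_succ, List.prod_cons, Fin.cons_zero, Fin.cons_succ]
      rw [← h, ← mul_assoc, ← mul_assoc, ((hg i.succ 0).pow_right _).eq]

theorem adjoin_range_le_span_prod_ofFn_pow {R A : Type*} [CommSemiring R] [Semiring A]
    [Algebra R A] {n : ℕ} (g : Fin n → A) (hg : ∀ i j, Commute (g i) (g j)) :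
    Subalgebra.toSubmodule (Algebra.adjoin R (Set.range g)) ≤
      Submodule.span R (Set.range fun α : Fin n → ℕ => (List.ofFn fun i => g i ^ α i).prod) := by
  rw [Algebra.adjoin_eq_span]
  refine Submodule.span_mono fun x hx => ?_
  induction hx using Submonoid.closure_induction_left with
  | one => exact ⟨0, by simp [List.ofFn_const]⟩
  | mul_left x hx y _ h =>
    obtain ⟨j, rfl⟩ := hx
    obtain ⟨α, rfl⟩ := h
    obtain ⟨α', h⟩ := exists_mul_prod_ofFn_pow g hg j α
    exact ⟨α', h.symm⟩

/-- The commutator with q ∈ s is a derivation, so it preserves the algebra generated by t once it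
sends the generators there. Hence the product on the right contains 1 and is stable under left
multiplication by s and t. -/
theorem adjoin_union_le_mul {R A : Type*} [CommRing R] [Ring A] [Algebra R A] (s t : Set A)
    (h : ∀ q ∈ s, ∀ p ∈ t, q * p - p * q ∈ Algebra.adjoin R t) :
    Subalgebra.toSubmodule (Algebra.adjoin R (s ∪ t)) ≤
      Subalgebra.toSubmodule (Algebra.adjoin R t) *
        Subalgebra.toSubmodule (Algebra.adjoin R s) := by
  set V := Subalgebra.toSubmodule (Algebra.adjoin R t) *
        Subalgebra.toSubmodule (Algebra.adjoin R s) with hV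
  have hcomm : ∀ q ∈ s, ∀ p ∈ Algebra.adjoin R t, q * p - p * q ∈ Algebra.adjoin R t := by
    intro q hq p hp
    induction hp using Algebra.adjoin_induction with
    | mem p hp => exact h q hq p hp
    | algebraMap r =>
      rw [(Algebra.commutes r q), sub_self]; exact zero_mem _
    | add x y _ _ hx hy =>
      have : q * (x + y) - (x + y) * q = (q * x - x * q) + (q * y - y * q) := by noncomm_ring
      rw [this]; exact add_mem hx hy
    | mul x y hx' hy' hx hy =>
      have : q * (x * y) - (x * y) * q = (q * x - x * q) * y + x * (q * y - y * q) := by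
        noncomm_ring
      rw [this]; exact add_mem (mul_mem hx hy') (mul_mem hx' hy)
  have hleft : ∀ x ∈ Algebra.adjoin R (s ∪ t), ∀ v ∈ V, x * v ∈ V := by
    intro x hx
    induction hx using Algebra.adjoin_induction with
    | mem x hx =>
      intro v hv
      refine Submodule.mul_induction_on hv (fun p hp q hq => ?_) (fun a b ha hb => ?_)
      · rcases hx with hx | hx
        · have : x * (p * q) = (x * p - p * x) * q + p * (x * q) := by noncomm_ring
          rw [this]
          exact add_mem (Submodule.mul_mem_mul (hcomm x hx p hp) hq)
            (Submodule.mul_mem_mul hp (Subalgebra.mul_mem _ (Algebra.subset_adjoin hx) hq))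
        · rw [← mul_assoc]
          exact Submodule.mul_mem_mul (Subalgebra.mul_mem _ (Algebra.subset_adjoin hx) hp) hq
      · rw [mul_add]; exact add_mem ha hb
    | algebraMap r =>
      intro v hv
      rw [← Algebra.smul_def]; exact V.smul_mem _ hv
    | add x y _ _ hx hy => intro v hv; rw [add_mul]; exact add_mem (hx v hv) (hy v hv)
    | mul x y _ _ hx hy => intro v hv; rw [mul_assoc]; exact hx _ (hy v hv)
  intro x hx
  have h1 : (1 : A) ∈ V := by
    rw [← one_mul (1 : A)]
    exact Submodule.mul_mem_mul (one_mem (Algebra.adjoin R t)) (one_mem (Algebra.adjoin R s))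
  simpa using hleft x hx 1 h1

/-! ### The algebra of positions and momenta, and boundedness of forms. -/

noncomputable section

variable {N : ℕ}

theorem posOp_commute (i j : Fin N) : Commute (posOp i) (posOp j) := by
  ext φ q
  change posOp i (posOp j φ) q = posOp j (posOp i φ) q
  simp only [posOp_apply]
  ring

/-- This transfers facts about positions to momenta: commutation and symmetry of the `momOp i` are
both deduced from those of `posOp i`. -/
theorem momOp_fourierInv (i : Fin N) (φ : 𝓢(Config N, ℂ)) :
    momOp i (𝓕⁻ φ) = ((2 * Real.pi : ℝ) : ℂ) • 𝓕⁻ (posOp i φ) := by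
  have h : (inner ℝ · (EuclideanSpace.single i (1 : ℝ)) : Config N → ℝ).HasTemperateGrowth := by
    fun_prop
  have h2 : SchwartzMap.smulLeftCLM ℂ (inner ℝ · (EuclideanSpace.single i (1 : ℝ))) φ =
      posOp i φ := by
    ext q
    rw [SchwartzMap.smulLeftCLM_apply_apply h, posOp_apply, EuclideanSpace.inner_single_right]
    simp
  change (-Complex.I) • LineDeriv.lineDerivOp (EuclideanSpace.single i (1 : ℝ)) (𝓕⁻ φ) = _
  rw [SchwartzMap.lineDerivOp_fourierInv_eq, h2, FourierTransform.fourierInv_smul, smul_smul]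
  congr 1
  push_cast
  linear_combination (-2 * (Real.pi : ℂ)) * Complex.I_mul_I

theorem momOp_eq (i : Fin N) (φ : 𝓢(Config N, ℂ)) :
    momOp i φ = ((2 * Real.pi : ℝ) : ℂ) • 𝓕⁻ (posOp i (𝓕 φ)) := by
  rw [← momOp_fourierInv, FourierTransform.fourierInv_fourier_eq]

theorem fourier_momOp (i : Fin N) (φ : 𝓢(Config N, ℂ)) :
    𝓕 (momOp i φ) = ((2 * Real.pi : ℝ) : ℂ) • posOp i (𝓕 φ) := by
  rw [momOp_eq, FourierTransform.fourier_smul, FourierTransform.fourier_fourierInv_eq]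

theorem fourierInv_momOp (i : Fin N) (φ : 𝓢(Config N, ℂ)) :
    𝓕⁻ (momOp i φ) = (-(2 * Real.pi : ℝ) : ℂ) • posOp i (𝓕⁻ φ) := by
  have h : (inner ℝ · (EuclideanSpace.single i (1 : ℝ)) : Config N → ℝ).HasTemperateGrowth := by
    fun_prop
  have h2 : SchwartzMap.smulLeftCLM ℂ (inner ℝ · (EuclideanSpace.single i (1 : ℝ))) (𝓕⁻ φ) =
      posOp i (𝓕⁻ φ) := by
    ext q
    rw [SchwartzMap.smulLeftCLM_apply_apply h, posOp_apply, EuclideanSpace.inner_single_right]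
    simp
  change 𝓕⁻ ((-Complex.I) • LineDeriv.lineDerivOp (EuclideanSpace.single i (1 : ℝ)) φ) = _
  rw [FourierTransform.fourierInv_smul, SchwartzMap.fourierInv_lineDerivOp_eq, h2, smul_smul]
  congr 1
  push_cast
  linear_combination (2 * (Real.pi : ℂ)) * Complex.I_mul_I

theorem momOp_commute (i j : Fin N) : Commute (momOp i) (momOp j) := by
  ext1 φ
  change momOp i (momOp j φ) = momOp j (momOp i φ)
  have h : posOp i (posOp j (𝓕 φ)) = posOp j (posOp i (𝓕 φ)) :=
    congrArg (fun A => A (𝓕 φ)) (posOp_commute i j).eq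
  rw [momOp_eq i, fourier_momOp, momOp_eq j (momOp i φ), fourier_momOp, map_smul, map_smul, h]

theorem posOp_momOp_commutator (i j : Fin N) :
    posOp i * momOp j - momOp j * posOp i =
      algebraMap ℂ _ (Complex.I * ((EuclideanSpace.single j (1 : ℝ) : Config N) i : ℝ)) := by
  ext φ q
  have hx : HasFDerivAt (fun q : Config N => ((q i : ℝ) : ℂ))
      (Complex.ofRealCLM ∘L (EuclideanSpace.proj i : Config N →L[ℝ] ℝ)) q :=
    (Complex.ofRealCLM ∘L (EuclideanSpace.proj i : Config N →L[ℝ] ℝ)).hasFDerivAt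
  have hd : fderiv ℝ (posOp i φ) q (EuclideanSpace.single j (1 : ℝ)) =
      (q i : ℂ) * fderiv ℝ φ q (EuclideanSpace.single j (1 : ℝ)) +
        ((EuclideanSpace.single j (1 : ℝ) : Config N) i : ℝ) * φ q := by
    have : (posOp i φ : Config N → ℂ) = fun q => ((q i : ℝ) : ℂ) * φ q :=
      funext fun q => posOp_apply i φ q
    rw [this, (HasFDerivAt.fun_mul hx (φ.hasFDerivAt q)).fderiv]
    simp
    ring
  change posOp i (momOp j φ) q - momOp j (posOp i φ) q = (Complex.I * _) * φ q
  rw [posOp_apply, momOp_apply, momOp_apply, hd]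
  ring

/-- The algebra of operators on Schwartz functions generated by positions and momenta. -/
def phaseAlgebra (N : ℕ) : Subalgebra ℂ (𝓢(Config N, ℂ) →L[ℂ] 𝓢(Config N, ℂ)) :=
  Algebra.adjoin ℂ (Set.range posOp ∪ Set.range momOp)

theorem posOp_mem (i : Fin N) : posOp i ∈ phaseAlgebra N :=
  Algebra.subset_adjoin (Or.inl ⟨i, rfl⟩)

theorem momOp_mem (i : Fin N) : momOp i ∈ phaseAlgebra N :=
  Algebra.subset_adjoin (Or.inr ⟨i, rfl⟩)

theorem posPow_mem (α : Fin N → ℕ) : posPow α ∈ phaseAlgebra N := by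
  refine list_prod_mem fun x hx => ?_
  obtain ⟨i, rfl⟩ := List.mem_ofFn.1 hx
  exact pow_mem (posOp_mem i) _

theorem momPow_mem (α : Fin N → ℕ) : momPow α ∈ phaseAlgebra N := by
  refine list_prod_mem fun x hx => ?_
  obtain ⟨i, rfl⟩ := List.mem_ofFn.1 hx
  exact pow_mem (momOp_mem i) _

/-- The canonical commutators are scalars, so momenta can be moved to the left of positions, the
order used in `IsSchwartzOperator`. -/
theorem phaseAlgebra_le_span :
    Subalgebra.toSubmodule (phaseAlgebra N) ≤
      Submodule.span ℂ {A | ∃ α β : Fin N → ℕ, A = momPow β * posPow α} := by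
  refine (adjoin_union_le_mul _ _ ?_).trans ?_
  · rintro _ ⟨i, rfl⟩ _ ⟨j, rfl⟩
    rw [posOp_momOp_commutator]
    exact Subalgebra.algebraMap_mem _ _
  · refine (mul_le_mul' (adjoin_range_le_span_prod_ofFn_pow _ momOp_commute)
      (adjoin_range_le_span_prod_ofFn_pow _ posOp_commute)).trans ?_
    rw [Submodule.span_mul_span]
    refine Submodule.span_mono ?_
    rintro _ ⟨_, ⟨β, rfl⟩, _, ⟨α, rfl⟩, rfl⟩
    exact ⟨α, β, rfl⟩

theorem schwartzVec_eq_toLpCLM (φ : 𝓢(Config N, ℂ)) :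
    schwartzVec φ = SchwartzMap.toLpCLM ℂ ℂ 2 volume φ := rfl

theorem schwartzVec_add (φ ψ : 𝓢(Config N, ℂ)) :
    schwartzVec (φ + ψ) = schwartzVec φ + schwartzVec ψ := by
  simp only [schwartzVec_eq_toLpCLM, map_add]

theorem schwartzVec_smul (c : ℂ) (φ : 𝓢(Config N, ℂ)) :
    schwartzVec (c • φ) = c • schwartzVec φ := by
  simp only [schwartzVec_eq_toLpCLM, map_smul]

theorem schwartzVec_zero : schwartzVec (0 : 𝓢(Config N, ℂ)) = 0 := by
  simp only [schwartzVec_eq_toLpCLM, map_zero]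

theorem schwartzVec_injective : Function.Injective (schwartzVec (N := N)) :=
  SchwartzMap.injective_toLp 2 volume

theorem inner_schwartzVec (ψ φ : 𝓢(Config N, ℂ)) :
    inner ℂ (schwartzVec ψ) (schwartzVec φ) = ∫ q, inner ℂ (ψ q) (φ q) :=
  SchwartzMap.inner_toL2_toL2_eq ψ φ

theorem inner_schwartzVec_fourier (ψ φ : 𝓢(Config N, ℂ)) :
    inner ℂ (schwartzVec (𝓕 ψ)) (schwartzVec (𝓕 φ)) =
      inner ℂ (schwartzVec ψ) (schwartzVec φ) :=
  SchwartzMap.inner_fourier_toL2_eq ψ φ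

theorem inner_posOp (i : Fin N) (ψ φ : 𝓢(Config N, ℂ)) :
    inner ℂ (schwartzVec (posOp i ψ)) (schwartzVec φ) =
      inner ℂ (schwartzVec ψ) (schwartzVec (posOp i φ)) := by
  simp only [inner_schwartzVec, posOp_apply, RCLike.inner_apply, map_mul, Complex.conj_ofReal]
  congr 1; ext q; ring

theorem inner_momOp (i : Fin N) (ψ φ : 𝓢(Config N, ℂ)) :
    inner ℂ (schwartzVec (momOp i ψ)) (schwartzVec φ) =
      inner ℂ (schwartzVec ψ) (schwartzVec (momOp i φ)) := by
  rw [← inner_schwartzVec_fourier, fourier_momOp, ← inner_schwartzVec_fourier ψ, fourier_momOp,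
    schwartzVec_smul, schwartzVec_smul, inner_smul_left, inner_smul_right, inner_posOp,
    Complex.conj_ofReal]

theorem exists_adjoint_mem {A : 𝓢(Config N, ℂ) →L[ℂ] 𝓢(Config N, ℂ)} (hA : A ∈ phaseAlgebra N) :
    ∃ B ∈ phaseAlgebra N, ∀ ψ φ, inner ℂ (schwartzVec (A ψ)) (schwartzVec φ) =
      inner ℂ (schwartzVec ψ) (schwartzVec (B φ)) := by
  induction hA using Algebra.adjoin_induction with
  | mem x hx =>
    rcases hx with ⟨i, rfl⟩ | ⟨i, rfl⟩
    · exact ⟨_, posOp_mem i, inner_posOp i⟩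
    · exact ⟨_, momOp_mem i, inner_momOp i⟩
  | algebraMap r =>
    refine ⟨algebraMap ℂ _ (starRingEnd ℂ r), Subalgebra.algebraMap_mem _ _, fun ψ φ => ?_⟩
    simp [Algebra.algebraMap_eq_smul_one, schwartzVec_smul, inner_smul_left, inner_smul_right]
  | add x y _ _ hx hy =>
    obtain ⟨x', hx', hx⟩ := hx
    obtain ⟨y', hy', hy⟩ := hy
    refine ⟨x' + y', add_mem hx' hy', fun ψ φ => ?_⟩
    simp [schwartzVec_add, inner_add_left, inner_add_right, hx, hy]
  | mul x y _ _ hx hy =>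
    obtain ⟨x', hx', hx⟩ := hx
    obtain ⟨y', hy', hy⟩ := hy
    refine ⟨y' * x', mul_mem hy' hx', fun ψ φ => ?_⟩
    simp [hx, hy]

theorem exists_fourierInv_conj {A : 𝓢(Config N, ℂ) →L[ℂ] 𝓢(Config N, ℂ)}
    (hA : A ∈ phaseAlgebra N) :
    ∃ B ∈ phaseAlgebra N, ∀ ψ : 𝓢(Config N, ℂ), 𝓕⁻ (A ψ) = B (𝓕⁻ ψ) := by
  induction hA using Algebra.adjoin_induction with
  | mem x hx =>
    rcases hx with ⟨i, rfl⟩ | ⟨i, rfl⟩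
    · refine ⟨((2 * Real.pi : ℝ) : ℂ)⁻¹ • momOp i,
        Subalgebra.smul_mem _ (momOp_mem i) _, fun ψ => ?_⟩
      rw [_root_.smul_apply, momOp_fourierInv, smul_smul, inv_mul_cancel₀, one_smul]
      exact_mod_cast Real.two_pi_pos.ne'
    · exact ⟨(-(2 * Real.pi : ℝ) : ℂ) • posOp i, Subalgebra.smul_mem _ (posOp_mem i) _,
        fun ψ => fourierInv_momOp i ψ⟩
  | algebraMap r =>
    refine ⟨algebraMap ℂ _ r, Subalgebra.algebraMap_mem _ _, fun ψ => ?_⟩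
    simp [Algebra.algebraMap_eq_smul_one, FourierTransform.fourierInv_smul]
  | add x y _ _ hx hy =>
    obtain ⟨x', hx', hx⟩ := hx
    obtain ⟨y', hy', hy⟩ := hy
    refine ⟨x' + y', add_mem hx' hy', fun ψ => ?_⟩
    simp [FourierTransform.fourierInv_add, hx, hy]
  | mul x y _ _ hx hy =>
    obtain ⟨x', hx', hx⟩ := hx
    obtain ⟨y', hy', hy⟩ := hy
    refine ⟨x' * y', mul_mem hx' hy', fun ψ => ?_⟩
    simp [hx, hy]

theorem exists_fourier_conj {A : 𝓢(Config N, ℂ) →L[ℂ] 𝓢(Config N, ℂ)}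
    (hA : A ∈ phaseAlgebra N) :
    ∃ B ∈ phaseAlgebra N, ∀ ψ : 𝓢(Config N, ℂ), 𝓕 (A ψ) = B (𝓕 ψ) := by
  induction hA using Algebra.adjoin_induction with
  | mem x hx =>
    rcases hx with ⟨i, rfl⟩ | ⟨i, rfl⟩
    · refine ⟨((-(2 * Real.pi : ℝ) : ℂ))⁻¹ • momOp i,
        Subalgebra.smul_mem _ (momOp_mem i) _, fun ψ => ?_⟩
      have h : 𝓕 (𝓕⁻ (momOp i (𝓕 ψ))) = 𝓕 (_ : 𝓢(Config N, ℂ)) :=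
        congrArg (fun χ : 𝓢(Config N, ℂ) => (𝓕 χ : 𝓢(Config N, ℂ))) (fourierInv_momOp i (𝓕 ψ))
      rw [FourierTransform.fourier_fourierInv_eq, FourierTransform.fourierInv_fourier_eq,
        FourierTransform.fourier_smul] at h
      rw [_root_.smul_apply, h, smul_smul, inv_mul_cancel₀, one_smul]
      rw [neg_ne_zero]
      exact_mod_cast Real.two_pi_pos.ne'
    · exact ⟨((2 * Real.pi : ℝ) : ℂ) • posOp i, Subalgebra.smul_mem _ (posOp_mem i) _,
        fun ψ => fourier_momOp i ψ⟩
  | algebraMap r =>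
    refine ⟨algebraMap ℂ _ r, Subalgebra.algebraMap_mem _ _, fun ψ => ?_⟩
    simp [Algebra.algebraMap_eq_smul_one, FourierTransform.fourier_smul]
  | add x y _ _ hx hy =>
    obtain ⟨x', hx', hx⟩ := hx
    obtain ⟨y', hy', hy⟩ := hy
    refine ⟨x' + y', add_mem hx' hy', fun ψ => ?_⟩
    simp [FourierTransform.fourier_add, hx, hy]
  | mul x y _ _ hx hy =>
    obtain ⟨x', hx', hx⟩ := hx
    obtain ⟨y', hy', hy⟩ := hy
    refine ⟨x' * y', mul_mem hx' hy', fun ψ => ?_⟩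
    simp [hx, hy]

theorem norm_schwartzVec_eq_zero {φ : 𝓢(Config N, ℂ)} : ‖schwartzVec φ‖ = 0 ↔ φ = 0 := by
  rw [norm_eq_zero, ← schwartzVec_zero, schwartzVec_injective.eq_iff]

/-- Boundedness of the form `(ψ, φ) ↦ ⟨A ψ, T B φ⟩`. -/
def FormBounded (T : PosHilbert N →L[ℂ] PosHilbert N)
    (A B : 𝓢(Config N, ℂ) →L[ℂ] 𝓢(Config N, ℂ)) : Prop :=
  ∃ C : ℝ, 0 ≤ C ∧ ∀ ψ φ, ‖inner ℂ (schwartzVec (A ψ)) (T (schwartzVec (B φ)))‖ ≤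
    C * ‖schwartzVec ψ‖ * ‖schwartzVec φ‖

theorem FormBounded.bddAbove {T : PosHilbert N →L[ℂ] PosHilbert N}
    {A B : 𝓢(Config N, ℂ) →L[ℂ] 𝓢(Config N, ℂ)} (h : FormBounded T A B) :
    BddAbove {r : ℝ | ∃ ψ φ : 𝓢(Config N, ℂ), ‖schwartzVec ψ‖ ≤ 1 ∧ ‖schwartzVec φ‖ ≤ 1 ∧
      r = ‖inner ℂ (schwartzVec (A ψ)) (T (schwartzVec (B φ)))‖} := by
  obtain ⟨C, hC, h⟩ := h
  refine ⟨C, ?_⟩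
  rintro _ ⟨ψ, φ, hψ, hφ, rfl⟩
  refine (h ψ φ).trans ?_
  calc C * ‖schwartzVec ψ‖ * ‖schwartzVec φ‖ ≤ C * 1 * 1 := by gcongr
    _ = C := by ring

theorem formBounded_of_bddAbove {T : PosHilbert N →L[ℂ] PosHilbert N}
    {A B : 𝓢(Config N, ℂ) →L[ℂ] 𝓢(Config N, ℂ)}
    (h : BddAbove {r : ℝ | ∃ ψ φ : 𝓢(Config N, ℂ), ‖schwartzVec ψ‖ ≤ 1 ∧ ‖schwartzVec φ‖ ≤ 1 ∧
      r = ‖inner ℂ (schwartzVec (A ψ)) (T (schwartzVec (B φ)))‖}) : FormBounded T A B := by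
  obtain ⟨C, hC⟩ := h
  refine ⟨|C|, abs_nonneg _, fun ψ φ => ?_⟩
  by_cases hψ : ‖schwartzVec ψ‖ = 0
  · simp [norm_schwartzVec_eq_zero.1 hψ, schwartzVec_zero]
  by_cases hφ : ‖schwartzVec φ‖ = 0
  · simp [norm_schwartzVec_eq_zero.1 hφ, schwartzVec_zero]
  have key := hC ⟨((‖schwartzVec ψ‖⁻¹ : ℝ) : ℂ) • ψ, ((‖schwartzVec φ‖⁻¹ : ℝ) : ℂ) • φ, by
    rw [schwartzVec_smul, norm_smul, Complex.norm_real, norm_inv, norm_norm, inv_mul_cancel₀ hψ],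
    by rw [schwartzVec_smul, norm_smul, Complex.norm_real, norm_inv, norm_norm,
      inv_mul_cancel₀ hφ], rfl⟩
  simp only [map_smul, schwartzVec_smul, inner_smul_left, inner_smul_right, norm_mul,
    Complex.conj_ofReal, Complex.norm_real, norm_inv, norm_norm] at key
  have hψ' : 0 < ‖schwartzVec ψ‖ := lt_of_le_of_ne (norm_nonneg _) (Ne.symm hψ)
  have hφ' : 0 < ‖schwartzVec φ‖ := lt_of_le_of_ne (norm_nonneg _) (Ne.symm hφ)
  rw [inv_mul_le_iff₀ hφ', inv_mul_le_iff₀ hψ'] at key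
  refine key.trans ?_
  calc ‖schwartzVec ψ‖ * (‖schwartzVec φ‖ * C) = C * ‖schwartzVec ψ‖ * ‖schwartzVec φ‖ := by ring
    _ ≤ _ := by gcongr; exact le_abs_self C

theorem FormBounded.of_mem_span_left {T : PosHilbert N →L[ℂ] PosHilbert N}
    {s : Set (𝓢(Config N, ℂ) →L[ℂ] 𝓢(Config N, ℂ))} {A B : 𝓢(Config N, ℂ) →L[ℂ] 𝓢(Config N, ℂ)}
    (h : ∀ A ∈ s, FormBounded T A B) (hA : A ∈ Submodule.span ℂ s) : FormBounded T A B := by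
  induction hA using Submodule.span_induction with
  | mem x hx => exact h x hx
  | zero => exact ⟨0, le_rfl, fun ψ φ => by simp [schwartzVec_zero]⟩
  | add x y _ _ hx hy =>
    obtain ⟨C, hC, hx⟩ := hx
    obtain ⟨D, hD, hy⟩ := hy
    refine ⟨C + D, add_nonneg hC hD, fun ψ φ => ?_⟩
    simp only [_root_.add_apply, schwartzVec_add, inner_add_left]
    refine (norm_add_le _ _).trans ((add_le_add (hx ψ φ) (hy ψ φ)).trans_eq ?_)
    ring
  | smul a x _ hx =>
    obtain ⟨C, hC, hx⟩ := hx
    refine ⟨‖a‖ * C, by positivity, fun ψ φ => ?_⟩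
    simp only [_root_.smul_apply, schwartzVec_smul, inner_smul_left, norm_mul,
      RCLike.norm_conj]
    calc _ ≤ ‖a‖ * (C * ‖schwartzVec ψ‖ * ‖schwartzVec φ‖) := by gcongr; exact hx ψ φ
      _ = _ := by ring

theorem FormBounded.of_mem_span_right {T : PosHilbert N →L[ℂ] PosHilbert N}
    {s : Set (𝓢(Config N, ℂ) →L[ℂ] 𝓢(Config N, ℂ))} {A B : 𝓢(Config N, ℂ) →L[ℂ] 𝓢(Config N, ℂ)}
    (h : ∀ B ∈ s, FormBounded T A B) (hB : B ∈ Submodule.span ℂ s) : FormBounded T A B := by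
  induction hB using Submodule.span_induction with
  | mem x hx => exact h x hx
  | zero => exact ⟨0, le_rfl, fun ψ φ => by simp [schwartzVec_zero]⟩
  | add x y _ _ hx hy =>
    obtain ⟨C, hC, hx⟩ := hx
    obtain ⟨D, hD, hy⟩ := hy
    refine ⟨C + D, add_nonneg hC hD, fun ψ φ => ?_⟩
    simp only [_root_.add_apply, schwartzVec_add, inner_add_right, map_add]
    refine (norm_add_le _ _).trans ((add_le_add (hx ψ φ) (hy ψ φ)).trans_eq ?_)
    ring
  | smul a x _ hx =>
    obtain ⟨C, hC, hx⟩ := hx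
    refine ⟨‖a‖ * C, by positivity, fun ψ φ => ?_⟩
    simp only [_root_.smul_apply, schwartzVec_smul, inner_smul_right, norm_mul,
      map_smul]
    calc _ ≤ ‖a‖ * (C * ‖schwartzVec ψ‖ * ‖schwartzVec φ‖) := by gcongr; exact hx ψ φ
      _ = _ := by ring

/-- Form-boundedness is preserved by linear combinations in each slot, and the normally ordered
monomials span. The gain is a condition indexed by an algebra, hence stable under products. -/
theorem isSchwartzOperator_iff {T : PosHilbert N →L[ℂ] PosHilbert N} :
    IsSchwartzOperator T ↔ ∀ A ∈ phaseAlgebra N, ∀ B ∈ phaseAlgebra N, FormBounded T A B := by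
  constructor
  · intro h A hA B hB
    refine FormBounded.of_mem_span_left ?_ (phaseAlgebra_le_span hA)
    rintro _ ⟨α, β, rfl⟩
    refine FormBounded.of_mem_span_right ?_ (phaseAlgebra_le_span hB)
    rintro _ ⟨α', β', rfl⟩
    exact formBounded_of_bddAbove (h α α' β β')
  · intro h α α' β β'
    exact (h _ (mul_mem (momPow_mem β) (posPow_mem α)) _
      (mul_mem (momPow_mem β') (posPow_mem α'))).bddAbove

end

/-! ### The common domain of the adjoints is the Schwartz space. -/

noncomputable section

variable {N : ℕ}

theorem ae_eq_of_forall_integral_inner_eq {f g : Config N → ℂ} (hf : LocallyIntegrable f)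
    (hg : LocallyIntegrable g)
    (h : ∀ ψ : 𝓢(Config N, ℂ), ∫ q, inner ℂ (ψ q) (f q) = ∫ q, inner ℂ (ψ q) (g q)) :
    f =ᵐ[volume] g := by
  refine ae_eq_of_integral_contDiff_smul_eq hf hg fun χ hχ hχc => ?_
  have hc : HasCompactSupport (fun q => (χ q : ℂ)) :=
    hχc.comp_left (g := fun x : ℝ => (x : ℂ)) Complex.ofReal_zero
  have hs : ContDiff ℝ ∞ (fun q => (χ q : ℂ)) := Complex.ofRealCLM.contDiff.comp hχ
  have key := h (hc.toSchwartzMap hs)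
  simpa [RCLike.inner_apply, mul_comm] using key

theorem inner_schwartzVec_left (ψ : 𝓢(Config N, ℂ)) (u : PosHilbert N) :
    inner ℂ (schwartzVec ψ) u = ∫ q, inner ℂ (ψ q) (u q) := by
  rw [L2.inner_def]
  refine integral_congr_ae ?_
  filter_upwards [SchwartzMap.coeFn_toLp ψ 2 volume] with q hq
  rw [schwartzVec, hq]

theorem locallyIntegrable_coeFn (u : PosHilbert N) : LocallyIntegrable u volume :=
  (Lp.memLp u).locallyIntegrable (by norm_num)

theorem locallyIntegrable_coordinate_mul (u : PosHilbert N) (i : Fin N) :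
    LocallyIntegrable (fun q : Config N => ((q i : ℝ) : ℂ) * u q) volume := by
  rw [← locallyIntegrableOn_univ]
  refine ((locallyIntegrableOn_univ.2 (locallyIntegrable_coeFn u)).continuousOn_mul
    (Continuous.continuousOn ?_) isOpen_univ.isLocallyClosed)
  fun_prop

theorem ae_eq_coordinate_mul {u v : PosHilbert N} {i : Fin N}
    (h : ∀ ψ, inner ℂ (schwartzVec (posOp i ψ)) u = inner ℂ (schwartzVec ψ) v) :
    v =ᵐ[volume] fun q => ((q i : ℝ) : ℂ) * u q := by
  refine ae_eq_of_forall_integral_inner_eq (locallyIntegrable_coeFn v)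
    (locallyIntegrable_coordinate_mul u i) fun ψ => ?_
  rw [← inner_schwartzVec_left, ← h, inner_schwartzVec_left]
  congr 1; ext q
  simp only [posOp_apply, RCLike.inner_apply, map_mul, Complex.conj_ofReal]
  ring

theorem denseRange_schwartzVec : DenseRange (schwartzVec (N := N)) :=
  SchwartzMap.denseRange_toLpCLM (F := ℂ) (E := Config N) (p := 2) ENNReal.ofNat_ne_top

/-- Vectors in the domain of the adjoint of every element of `phaseAlgebra N`. -/
def smoothDomain (N : ℕ) : Submodule ℂ (PosHilbert N) where
  carrier := {u | ∀ A ∈ phaseAlgebra N, ∃ v, ∀ ψ,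
    inner ℂ (schwartzVec (A ψ)) u = inner ℂ (schwartzVec ψ) v}
  zero_mem' := fun A _ => ⟨0, by simp⟩
  add_mem' := by
    intro a b ha hb A hA
    obtain ⟨v, hv⟩ := ha A hA
    obtain ⟨w, hw⟩ := hb A hA
    exact ⟨v + w, fun ψ => by rw [inner_add_right, inner_add_right, hv, hw]⟩
  smul_mem' := by
    intro c a ha A hA
    obtain ⟨v, hv⟩ := ha A hA
    exact ⟨c • v, fun ψ => by rw [inner_smul_right, inner_smul_right, hv]⟩

theorem exists_mem_smoothDomain {u : PosHilbert N} (hu : u ∈ smoothDomain N)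
    {A : 𝓢(Config N, ℂ) →L[ℂ] 𝓢(Config N, ℂ)} (hA : A ∈ phaseAlgebra N) :
    ∃ v ∈ smoothDomain N, ∀ ψ, inner ℂ (schwartzVec (A ψ)) u = inner ℂ (schwartzVec ψ) v := by
  obtain ⟨v, hv⟩ := hu A hA
  refine ⟨v, fun B hB => ?_, hv⟩
  obtain ⟨w, hw⟩ := hu (A * B) (mul_mem hA hB)
  exact ⟨w, fun ψ => by rw [← hv, ← hw]; rfl⟩

theorem exists_smoothDomain_coordinate_mul {u : PosHilbert N} (hu : u ∈ smoothDomain N)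
    (i : Fin N) : ∃ v ∈ smoothDomain N, v =ᵐ[volume] fun q => ((q i : ℝ) : ℂ) * u q := by
  obtain ⟨v, hv, h⟩ := exists_mem_smoothDomain hu (posOp_mem i)
  exact ⟨v, hv, ae_eq_coordinate_mul h⟩

theorem inner_schwartzVec_fourier_left (ψ : 𝓢(Config N, ℂ)) (u : PosHilbert N) :
    inner ℂ (schwartzVec (𝓕 ψ)) u = inner ℂ (schwartzVec ψ) (𝓕⁻ u) := by
  rw [← Lp.inner_fourier_eq (schwartzVec ψ), FourierTransform.fourier_fourierInv_eq, schwartzVec,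
    schwartzVec, SchwartzMap.toLp_fourier_eq]

theorem inner_schwartzVec_fourierInv_left (ψ : 𝓢(Config N, ℂ)) (u : PosHilbert N) :
    inner ℂ (schwartzVec (𝓕⁻ ψ)) u = inner ℂ (schwartzVec ψ) (𝓕 u) := by
  rw [← Lp.inner_fourier_eq (schwartzVec (𝓕⁻ ψ)), schwartzVec, SchwartzMap.toLp_fourier_eq,
    FourierTransform.fourier_fourierInv_eq, schwartzVec]

theorem fourier_mem_smoothDomain {u : PosHilbert N} (hu : u ∈ smoothDomain N) :
    𝓕 u ∈ smoothDomain N := by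
  intro A hA
  obtain ⟨B, hB, h⟩ := exists_fourierInv_conj hA
  obtain ⟨v, hv⟩ := hu B hB
  refine ⟨𝓕 v, fun ψ => ?_⟩
  rw [← inner_schwartzVec_fourierInv_left, ← inner_schwartzVec_fourierInv_left, h, hv]

theorem fourierInv_mem_smoothDomain {u : PosHilbert N} (hu : u ∈ smoothDomain N) :
    𝓕⁻ u ∈ smoothDomain N := by
  intro A hA
  obtain ⟨B, hB, h⟩ := exists_fourier_conj hA
  obtain ⟨v, hv⟩ := hu B hB
  refine ⟨𝓕⁻ v, fun ψ => ?_⟩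
  rw [← inner_schwartzVec_fourier_left, ← inner_schwartzVec_fourier_left, h, hv]

theorem continuous_fourier_coeFn {u : PosHilbert N} (hu : Integrable u volume) :
    Continuous (𝓕 (u : Config N → ℂ)) :=
  VectorFourier.fourierIntegral_continuous Real.continuous_fourierChar
    (by exact continuous_inner) hu

/-- Both sides pair in the same way with Schwartz functions: the integral by Fubini, the L²
transform by unitarity. -/
theorem fourier_coeFn_ae_eq {u : PosHilbert N} (hu : Integrable u volume) :
    𝓕 (u : Config N → ℂ) =ᵐ[volume] (𝓕 u : PosHilbert N) := by
  refine ae_eq_of_forall_integral_inner_eq (continuous_fourier_coeFn hu).locallyIntegrable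
    (locallyIntegrable_coeFn _)
    fun ψ => ?_
  rw [← inner_schwartzVec_left, ← inner_schwartzVec_fourierInv_left, inner_schwartzVec_left]
  have key : ∫ ξ, inner ℂ (𝓕 (u : Config N → ℂ) ξ) (ψ ξ) = ∫ x, inner ℂ (u x) (𝓕⁻ ψ x) := by
    simpa [SchwartzMap.fourierInv_coe] using!
      VectorFourier.integral_sesq_fourierIntegral_eq_neg_flip (innerSL ℂ) (L := innerₗ (Config N))
      Real.continuous_fourierChar (by exact continuous_inner) hu ψ.integrable
  have := congrArg (starRingEnd ℂ) key
  rw [← integral_conj, ← integral_conj] at this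
  simpa only [inner_conj_symm] using this

theorem coeFn_sum_ae_eq {ι : Type*} (s : Finset ι) (z : ι → PosHilbert N) :
    ((∑ i ∈ s, z i : PosHilbert N) : Config N → ℂ) =ᵐ[volume] fun q => ∑ i ∈ s, z i q := by
  classical
  induction s using Finset.induction_on with
  | empty =>
    simp only [Finset.sum_empty]
    exact Lp.coeFn_zero ℂ 2 volume
  | insert a s ha ih =>
    rw [Finset.sum_insert ha]
    filter_upwards [Lp.coeFn_add (z a) (∑ i ∈ s, z i), ih] with q h1 h2
    rw [h1, Pi.add_apply, h2, Finset.sum_insert ha]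

theorem exists_smoothDomain_weight_mul {u : PosHilbert N} (hu : u ∈ smoothDomain N) (m : ℕ) :
    ∃ v ∈ smoothDomain N, v =ᵐ[volume] fun q => (((1 + ‖q‖ ^ 2) ^ m : ℝ) : ℂ) * u q := by
  induction m with
  | zero => exact ⟨u, hu, by simp⟩
  | succ m ih =>
    obtain ⟨v, hv, hvu⟩ := ih
    choose w hw hwv using fun i => exists_smoothDomain_coordinate_mul hv i
    choose z hz hzw using fun i => exists_smoothDomain_coordinate_mul (hw i) i
    refine ⟨v + ∑ i, z i, add_mem hv (sum_mem fun i _ => hz i), ?_⟩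
    have hsum := coeFn_sum_ae_eq Finset.univ z
    filter_upwards [Lp.coeFn_add v (∑ i, z i), hsum, hvu, ae_all_iff.2 hwv, ae_all_iff.2 hzw]
      with q h1 h2 h3 h4 h5
    rw [h1, Pi.add_apply, h2]
    have hn : ((‖q‖ ^ 2 : ℝ) : ℂ) = ∑ i, ((q i : ℝ) : ℂ) * q i := by
      rw [EuclideanSpace.norm_sq_eq, Complex.ofReal_sum]
      refine Finset.sum_congr rfl fun i _ => ?_
      rw [Real.norm_eq_abs, sq_abs, sq, Complex.ofReal_mul]
    have hz : ∑ i, z i q = ((‖q‖ ^ 2 : ℝ) : ℂ) * v q := by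
      rw [hn, Finset.sum_mul]
      exact Finset.sum_congr rfl fun i _ => by rw [h5, h4, mul_assoc]
    rw [hz, h3]
    push_cast
    ring

theorem memLp_weight (N : ℕ) :
    MemLp (fun q : Config N => (1 + ‖q‖ ^ 2 : ℝ) ^ (-((N : ℝ) + 1))) 2 volume := by
  have hc : Continuous fun q : Config N => (1 + ‖q‖ ^ 2 : ℝ) ^ (-((N : ℝ) + 1)) :=
    Continuous.rpow_const (by fun_prop) fun q => Or.inl (by positivity)
  rw [memLp_two_iff_integrable_sq hc.aestronglyMeasurable]
  -- The squared weight is (1+|q|²)^(-r/2) with r = 4(N+1), integrable as soon as r > N.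
  have h : (Module.finrank ℝ (Config N) : ℝ) < 4 * (N + 1) := by
    rw [finrank_euclideanSpace_fin]
    have : (0 : ℝ) ≤ N := Nat.cast_nonneg N
    linarith
  refine (integrable_rpow_neg_one_add_norm_sq (μ := (volume : Measure (Config N))) h).congr
    (Filter.Eventually.of_forall fun q => ?_)
  change _ = _ ^ 2
  rw [← Real.rpow_mul_natCast (by positivity)]
  push_cast; ring_nf

theorem integrable_of_mem_smoothDomain {u : PosHilbert N} (hu : u ∈ smoothDomain N) :
    Integrable u volume := by
  obtain ⟨v, -, hv⟩ := exists_smoothDomain_weight_mul hu (N + 1)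
  -- Here u is the product of the L² weight and v = (1+|q|²)^(N+1) u, also in L².
  have := ((memLp_weight N).ofReal (K := ℂ)).integrable_mul (Lp.memLp v)
  refine this.congr ?_
  filter_upwards [hv] with q hq
  have h1 : (0 : ℝ) < 1 + ‖q‖ ^ 2 := by positivity
  have h2 : (1 + ‖q‖ ^ 2 : ℝ) ^ (-((N : ℝ) + 1)) * (1 + ‖q‖ ^ 2) ^ (N + 1) = 1 := by
    rw [← Real.rpow_natCast (1 + ‖q‖ ^ 2), ← Real.rpow_add h1]
    simp
  rw [Pi.mul_apply, hq, ← mul_assoc]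
  simp only [RCLike.ofReal_eq_complex_ofReal]
  rw [← Complex.ofReal_mul, h2, Complex.ofReal_one, one_mul]

theorem integrable_norm_mul_of_mem_smoothDomain {u : PosHilbert N} (hu : u ∈ smoothDomain N) :
    Integrable (fun q => ‖q‖ * ‖u q‖) volume := by
  obtain ⟨v, hv, h⟩ := exists_smoothDomain_weight_mul hu 1
  refine (integrable_of_mem_smoothDomain hv).norm.mono' ?_ ?_
  · exact (continuous_norm.aestronglyMeasurable).mul (Lp.aestronglyMeasurable u).norm
  · filter_upwards [h] with q hq
    rw [hq, norm_mul, norm_mul, norm_norm, norm_norm, Complex.norm_real, Real.norm_eq_abs, pow_one]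
    gcongr
    rw [abs_of_nonneg (by positivity)]
    nlinarith [sq_nonneg (‖q‖ - 1)]

/-- Continuous functions whose class lies in the smooth domain. -/
def IsSmoothRep (f : Config N → ℂ) : Prop :=
  Continuous f ∧ ∃ u ∈ smoothDomain N, f =ᵐ[volume] u

theorem IsSmoothRep.weight_mul {f : Config N → ℂ} (hf : IsSmoothRep f) (m : ℕ) :
    IsSmoothRep fun q => (((1 + ‖q‖ ^ 2) ^ m : ℝ) : ℂ) * f q := by
  obtain ⟨hc, u, hu, hfu⟩ := hf
  obtain ⟨v, hv, h⟩ := exists_smoothDomain_weight_mul hu m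
  refine ⟨by fun_prop, v, hv, ?_⟩
  filter_upwards [hfu, h] with q h1 h2
  rw [h1, h2]

/-- The smooth domain is Fourier invariant and consists of integrable functions, so Fourier
inversion holds a.e.; continuity of both sides upgrades it to everywhere. Boundedness and
differentiability are then read off the Fourier integral. -/
theorem IsSmoothRep.exists_eq_fourier {f : Config N → ℂ} (hf : IsSmoothRep f) :
    ∃ w ∈ smoothDomain N, f = 𝓕 (w : Config N → ℂ) := by
  obtain ⟨hc, u, hu, hfu⟩ := hf
  have hw := fourierInv_mem_smoothDomain hu
  have hi := integrable_of_mem_smoothDomain hw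
  refine ⟨𝓕⁻ u, hw, ?_⟩
  rw [← hc.ae_eq_iff_eq volume (continuous_fourier_coeFn hi)]
  refine hfu.trans ?_
  have := fourier_coeFn_ae_eq hi
  rw [FourierTransform.fourier_fourierInv_eq] at this
  exact this.symm

theorem isSmoothRep_fourier {w : PosHilbert N} (hw : w ∈ smoothDomain N) :
    IsSmoothRep (𝓕 (w : Config N → ℂ)) :=
  ⟨continuous_fourier_coeFn (integrable_of_mem_smoothDomain hw), 𝓕 w, fourier_mem_smoothDomain hw,
    fourier_coeFn_ae_eq (integrable_of_mem_smoothDomain hw)⟩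

theorem IsSmoothRep.bounded {f : Config N → ℂ} (hf : IsSmoothRep f) : ∃ C, ∀ q, ‖f q‖ ≤ C := by
  obtain ⟨w, hw, rfl⟩ := hf.exists_eq_fourier
  exact ⟨_, fun q => VectorFourier.norm_fourierIntegral_le_integral_norm _ _ _ _ q⟩

theorem IsSmoothRep.differentiable {f : Config N → ℂ} (hf : IsSmoothRep f) :
    Differentiable ℝ f := by
  obtain ⟨w, hw, rfl⟩ := hf.exists_eq_fourier
  exact Real.differentiable_fourier (integrable_of_mem_smoothDomain hw)
    (integrable_norm_mul_of_mem_smoothDomain hw)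

/-- If f = 𝓕 w, then ∂_i f is the transform of -2πi q_i w, which stays in the smooth domain. This
closure drives the inductions for smoothness and decay. -/
theorem IsSmoothRep.partialDeriv {f : Config N → ℂ} (hf : IsSmoothRep f) (i : Fin N) :
    IsSmoothRep fun q => fderiv ℝ f q (EuclideanSpace.single i 1) := by
  obtain ⟨w, hw, rfl⟩ := hf.exists_eq_fourier
  obtain ⟨v, hv, h⟩ := exists_smoothDomain_coordinate_mul hw i
  have hi := integrable_of_mem_smoothDomain hw
  have hi' := integrable_norm_mul_of_mem_smoothDomain hw
  have hint : Integrable (VectorFourier.fourierSMulRight (innerSL ℝ) (w : Config N → ℂ))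
      volume := by
    refine (hi'.const_mul (2 * Real.pi * ‖innerSL (E := Config N) ℝ‖)).mono'
      hi.aestronglyMeasurable.fourierSMulRight ?_
    refine Filter.Eventually.of_forall fun q => ?_
    refine (VectorFourier.norm_fourierSMulRight_le (innerSL ℝ) _ q).trans_eq ?_
    ring
  have key : (fun q => fderiv ℝ (𝓕 (w : Config N → ℂ)) q (EuclideanSpace.single i 1)) =
      𝓕 (((-(2 * Real.pi * Complex.I)) • v : PosHilbert N) : Config N → ℂ) := by
    ext q
    rw [Real.fderiv_fourier hi hi', Real.fourier_continuousLinearMap_apply hint]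
    rw [Real.fourier_eq, Real.fourier_eq]
    refine integral_congr_ae ?_
    filter_upwards [h, Lp.coeFn_smul (-(2 * Real.pi * Complex.I)) v] with x hx hx2
    rw [hx2, Pi.smul_apply, hx]
    congr 1
    have hin : innerSL ℝ x (EuclideanSpace.single i (1 : ℝ)) = x i := by
      rw [innerSL_apply_apply, EuclideanSpace.inner_single_right]
      simp
    rw [VectorFourier.fourierSMulRight_apply, hin, Complex.real_smul, smul_eq_mul]
  rw [key]
  exact isSmoothRep_fourier (Submodule.smul_mem _ _ hv)

theorem fderiv_eq_sum_partialDeriv (f : Config N → ℂ) :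
    fderiv ℝ f = fun q => ∑ i : Fin N,
      (ContinuousLinearMap.smulRightL ℝ (Config N) ℂ (EuclideanSpace.proj i) ∘
        fun q => fderiv ℝ f q (EuclideanSpace.single i 1)) q := by
  ext q x
  conv_lhs => rw [← (EuclideanSpace.basisFun (Fin N) ℝ).sum_repr x]
  simp

theorem IsSmoothRep.contDiff (n : ℕ) : ∀ {f : Config N → ℂ}, IsSmoothRep f → ContDiff ℝ n f := by
  induction n with
  | zero => intro f hf; exact contDiff_zero.2 hf.1
  | succ n ih =>
    intro f hf
    push_cast
    rw [contDiff_succ_iff_fderiv]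
    refine ⟨hf.differentiable, fun h => absurd h (by simp), ?_⟩
    rw [fderiv_eq_sum_partialDeriv f]
    exact ContDiff.sum fun i _ => (ContinuousLinearMap.contDiff _).comp (ih (hf.partialDeriv i))

theorem IsSmoothRep.decay (k n : ℕ) : ∀ {f : Config N → ℂ}, IsSmoothRep f →
    ∃ C, ∀ q, ‖q‖ ^ k * ‖iteratedFDeriv ℝ n f q‖ ≤ C := by
  induction n with
  | zero =>
    intro f hf
    obtain ⟨C, hC⟩ := (hf.weight_mul k).bounded
    refine ⟨C, fun q => le_trans ?_ (hC q)⟩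
    rw [norm_iteratedFDeriv_zero, norm_mul, Complex.norm_real, Real.norm_eq_abs, abs_pow]
    gcongr
    rw [abs_of_nonneg (by positivity)]
    nlinarith [sq_nonneg (‖q‖ - 1)]
  | succ n ih =>
    intro f hf
    choose C hC using fun i => ih (hf.partialDeriv i)
    refine ⟨∑ i, ‖ContinuousLinearMap.smulRightL ℝ (Config N) ℂ (EuclideanSpace.proj i)‖ * C i,
      fun q => ?_⟩
    have hcd : ∀ i, ContDiff ℝ n fun q => fderiv ℝ f q (EuclideanSpace.single i 1) :=
      fun i => (hf.partialDeriv i).contDiff n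
    rw [← norm_iteratedFDeriv_fderiv, fderiv_eq_sum_partialDeriv f, iteratedFDeriv_sum
      fun i _ => (ContinuousLinearMap.contDiff _).comp (hcd i), Finset.sum_apply]
    calc _ ≤ ‖q‖ ^ k * ∑ i, ‖ContinuousLinearMap.smulRightL ℝ (Config N) ℂ
          (EuclideanSpace.proj i)‖ * ‖iteratedFDeriv ℝ n
            (fun q => fderiv ℝ f q (EuclideanSpace.single i 1)) q‖ := by
          gcongr
          refine (norm_sum_le _ _).trans (Finset.sum_le_sum fun i _ => ?_)
          exact ContinuousLinearMap.norm_iteratedFDeriv_comp_left _ (hcd i).contDiffAt le_rfl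
      _ = ∑ i, ‖ContinuousLinearMap.smulRightL ℝ (Config N) ℂ (EuclideanSpace.proj i)‖ *
          (‖q‖ ^ k * ‖iteratedFDeriv ℝ n
            (fun q => fderiv ℝ f q (EuclideanSpace.single i 1)) q‖) := by
          rw [Finset.mul_sum]
          exact Finset.sum_congr rfl fun i _ => by ring
      _ ≤ _ := by
          gcongr with i
          exact hC i q

/-- A vector in the domain of the adjoints of all position-momentum polynomials is the class of a
Schwartz function. -/
theorem exists_schwartzVec_eq {u : PosHilbert N} (hu : u ∈ smoothDomain N) :
    ∃ φ, schwartzVec φ = u := by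
  have hw := fourierInv_mem_smoothDomain hu
  have hf := isSmoothRep_fourier hw
  have hae := fourier_coeFn_ae_eq (integrable_of_mem_smoothDomain hw)
  rw [FourierTransform.fourier_fourierInv_eq] at hae
  refine ⟨⟨_, contDiff_infty.2 fun n => hf.contDiff n, fun k n => hf.decay k n⟩, ?_⟩
  exact Lp.ext ((SchwartzMap.coeFn_toLp _ 2 volume).trans hae)

end

/-! ### Log-convexity and square roots of Schwartz operators. -/

noncomputable section

/-- Log-convexity makes the ratios a(n+1)/a(n) nondecreasing. If the first ratio r exceeded M, then
a(n+1) ≥ rⁿ a(1) would outgrow K Mⁿ. The constant K does not enter the conclusion. -/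
theorem le_mul_of_sq_le_mul_of_le_pow {a : ℕ → ℝ} {K M : ℝ} (ha : ∀ n, 0 ≤ a n) (hM : 0 ≤ M)
    (hlog : ∀ n, a (n + 1) ^ 2 ≤ a n * a (n + 2)) (hK : ∀ n, a (n + 1) ≤ K * M ^ n) :
    a 1 ≤ M * a 0 := by
  by_contra! hlt
  have h1 : 0 < a 1 := lt_of_le_of_lt (mul_nonneg hM (ha 0)) hlt
  have h0 : 0 < a 0 := by
    have := hlog 0
    by_contra! h
    have h00 : a 0 = 0 := le_antisymm h (ha 0)
    rw [h00, zero_mul] at this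
    nlinarith
  set r := a 1 / a 0 with hr
  have hr0 : 0 < r := div_pos h1 h0
  have hMr : M < r := by rwa [hr, lt_div_iff₀ h0]
  have hstep : ∀ n, 0 < a n ∧ r * a n ≤ a (n + 1) := by
    intro n
    induction n with
    | zero => exact ⟨h0, by rw [hr, div_mul_cancel₀ _ h0.ne']⟩
    | succ n ih =>
      obtain ⟨hn, hle⟩ := ih
      have hpos : 0 < a (n + 1) := lt_of_lt_of_le (mul_pos hr0 hn) hle
      refine ⟨hpos, ?_⟩
      have h2 := hlog n
      have h3 : a n * (r * a (n + 1)) ≤ a n * a (n + 2) := by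
        calc a n * (r * a (n + 1)) = (r * a n) * a (n + 1) := by ring
          _ ≤ a (n + 1) * a (n + 1) := by gcongr
          _ = a (n + 1) ^ 2 := by ring
          _ ≤ _ := h2
      exact le_of_mul_le_mul_left h3 hn
  have hgrow : ∀ n, r ^ n * a 1 ≤ a (n + 1) := by
    intro n
    induction n with
    | zero => simp
    | succ n ih =>
      calc r ^ (n + 1) * a 1 = r * (r ^ n * a 1) := by ring
        _ ≤ r * a (n + 1) := by gcongr
        _ ≤ _ := (hstep (n + 1)).2
  have hMr1 : M / r < 1 := by rwa [div_lt_one hr0]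
  have hlim : Filter.Tendsto (fun n => K * (M / r) ^ n) Filter.atTop (nhds (K * 0)) :=
    (tendsto_pow_atTop_nhds_zero_of_lt_one (div_nonneg hM hr0.le) hMr1).const_mul K
  have hle : a 1 ≤ K * 0 := by
    refine ge_of_tendsto' hlim fun n => ?_
    have h := (hgrow n).trans (hK n)
    rw [div_pow, ← mul_div_assoc, le_div_iff₀ (pow_pos hr0 n), mul_comm]
    exact h
  linarith

variable {N : ℕ}

theorem norm_le_of_inner_iterate {Y : 𝓢(Config N, ℂ) → 𝓢(Config N, ℂ)}
    (hY : ∀ φ χ, inner ℂ (schwartzVec (Y φ)) (schwartzVec χ) =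
      inner ℂ (schwartzVec φ) (schwartzVec (Y χ))) {φ : 𝓢(Config N, ℂ)} {K M : ℝ} (hM : 0 ≤ M)
    (hK : ∀ n, ‖schwartzVec (Y^[n + 1] φ)‖ ≤ K * M ^ n) :
    ‖schwartzVec (Y φ)‖ ≤ M * ‖schwartzVec φ‖ := by
  refine le_mul_of_sq_le_mul_of_le_pow (a := fun n => ‖schwartzVec (Y^[n] φ)‖)
    (fun n => norm_nonneg _) hM (fun n => ?_) hK
  have h : inner ℂ (schwartzVec (Y^[n + 1] φ)) (schwartzVec (Y^[n + 1] φ)) =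
      inner ℂ (schwartzVec (Y^[n] φ)) (schwartzVec (Y^[n + 2] φ)) := by
    rw [Function.iterate_succ_apply' Y (n + 1), ← hY, ← Function.iterate_succ_apply' Y n]
  have h2 := norm_inner_le_norm (𝕜 := ℂ) (schwartzVec (Y^[n] φ)) (schwartzVec (Y^[n + 2] φ))
  rw [← h, inner_self_eq_norm_sq_to_K] at h2
  simpa using h2

/-- Boundedness of `T A` on Schwartz functions, for all position-momentum polynomials `A`. -/
def RightBounded (T : PosHilbert N →L[ℂ] PosHilbert N) : Prop :=
  ∀ A ∈ phaseAlgebra N, ∃ C, 0 ≤ C ∧ ∀ φ, ‖T (schwartzVec (A φ))‖ ≤ C * ‖schwartzVec φ‖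

theorem norm_le_of_forall_inner_schwartzVec {v : PosHilbert N} {C : ℝ} (hC : 0 ≤ C)
    (h : ∀ ψ, ‖inner ℂ (schwartzVec ψ) v‖ ≤ C * ‖schwartzVec ψ‖) : ‖v‖ ≤ C := by
  have hall : ∀ u : PosHilbert N, ‖inner ℂ u v‖ ≤ C * ‖u‖ := fun u =>
    denseRange_schwartzVec.induction_on u
      (isClosed_le (by fun_prop) (by fun_prop)) h
  by_cases hv : ‖v‖ = 0
  · rw [hv]; exact hC
  · have := hall v
    rw [inner_self_eq_norm_sq_to_K] at this
    have hv' : 0 < ‖v‖ := lt_of_le_of_ne (norm_nonneg _) (Ne.symm hv)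
    have h2 : ‖v‖ * ‖v‖ ≤ C * ‖v‖ := by simpa [sq] using this
    exact le_of_mul_le_mul_right h2 hv'

theorem IsSchwartzOperator.rightBounded {T : PosHilbert N →L[ℂ] PosHilbert N}
    (hT : IsSchwartzOperator T) : RightBounded T := by
  intro A hA
  obtain ⟨C, hC, h⟩ := isSchwartzOperator_iff.1 hT 1 (one_mem _) A hA
  refine ⟨C, hC, fun φ => ?_⟩
  refine norm_le_of_forall_inner_schwartzVec (by positivity) fun ψ => ?_
  calc _ ≤ C * ‖schwartzVec ψ‖ * ‖schwartzVec φ‖ := h ψ φ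
    _ = _ := by ring

/-- The densely defined bounded map S A extends to R on all of L², and R* u is the vector
representing the functional. -/
theorem RightBounded.mem_smoothDomain {S : PosHilbert N →L[ℂ] PosHilbert N}
    (hS : RightBounded S) (u : PosHilbert N) : S.adjoint u ∈ smoothDomain N := by
  intro A hA
  obtain ⟨C, -, h⟩ := hS A hA
  let f : 𝓢(Config N, ℂ) →ₗ[ℂ] PosHilbert N :=
    S.toLinearMap ∘ₗ (SchwartzMap.toLpCLM ℂ ℂ 2 volume).toLinearMap ∘ₗ A.toLinearMap
  let e : 𝓢(Config N, ℂ) →ₗ[ℂ] PosHilbert N := (SchwartzMap.toLpCLM ℂ ℂ 2 volume).toLinearMap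
  let R : PosHilbert N →L[ℂ] PosHilbert N := f.extendOfNorm e
  have hR : ∀ ψ, R (schwartzVec ψ) = S (schwartzVec (A ψ)) := fun ψ =>
    LinearMap.extendOfNorm_eq (f := f) (e := e) denseRange_schwartzVec ⟨C, h⟩ ψ
  refine ⟨R.adjoint u, fun ψ => ?_⟩
  rw [ContinuousLinearMap.adjoint_inner_right, ContinuousLinearMap.adjoint_inner_right, hR]

/-- One-sided boundedness becomes two-sided for self-adjoint S. Bounds on S A and, by duality, on
A†S do not directly control A†SB; the iteration of X†X does. -/
theorem RightBounded.formBounded {S : PosHilbert N →L[ℂ] PosHilbert N}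
    (hsa : S.adjoint = S) (hS : RightBounded S)
    {A B : 𝓢(Config N, ℂ) →L[ℂ] 𝓢(Config N, ℂ)} (hA : A ∈ phaseAlgebra N)
    (hB : B ∈ phaseAlgebra N) : FormBounded S A B := by
  have hsym : ∀ u v : PosHilbert N, inner ℂ (S u) v = inner ℂ u (S v) := fun u v => by
    rw [← ContinuousLinearMap.adjoint_inner_right, hsa]
  have hex : ∀ φ, ∃ χ, schwartzVec χ = S (schwartzVec φ) := fun φ =>
    exists_schwartzVec_eq (by simpa only [hsa] using hS.mem_smoothDomain (schwartzVec φ))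
  choose σ hσ using hex
  obtain ⟨A', hA', hAA'⟩ := exists_adjoint_mem hA
  obtain ⟨B', hB', hBB'⟩ := exists_adjoint_mem hB
  have hleft : ∀ D ∈ phaseAlgebra N, ∀ D' ∈ phaseAlgebra N,
      (∀ ψ φ, inner ℂ (schwartzVec (D ψ)) (schwartzVec φ) =
        inner ℂ (schwartzVec ψ) (schwartzVec (D' φ))) →
      ∃ C, 0 ≤ C ∧ ∀ χ, ‖schwartzVec (D' (σ χ))‖ ≤ C * ‖schwartzVec χ‖ := by
    intro D hD D' hD' hDD'
    obtain ⟨C, hC, h⟩ := hS D hD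
    refine ⟨C, hC, fun χ => norm_le_of_forall_inner_schwartzVec (by positivity) fun ψ => ?_⟩
    rw [← hDD', hσ, ← hsym]
    refine (norm_inner_le_norm _ _).trans ?_
    calc _ ≤ C * ‖schwartzVec ψ‖ * ‖schwartzVec χ‖ := by gcongr; exact h ψ
      _ = _ := by ring
  have hswap : ∀ {D D' : 𝓢(Config N, ℂ) →L[ℂ] 𝓢(Config N, ℂ)},
      (∀ ψ φ, inner ℂ (schwartzVec (D ψ)) (schwartzVec φ) =
        inner ℂ (schwartzVec ψ) (schwartzVec (D' φ))) →
      ∀ ψ φ, inner ℂ (schwartzVec (D' ψ)) (schwartzVec φ) =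
        inner ℂ (schwartzVec ψ) (schwartzVec (D φ)) := fun h ψ φ => by
    rw [← inner_conj_symm, ← h, inner_conj_symm]
  have hself : ∀ {D D' : 𝓢(Config N, ℂ) →L[ℂ] 𝓢(Config N, ℂ)},
      (∀ ψ φ, inner ℂ (schwartzVec (D ψ)) (schwartzVec φ) =
        inner ℂ (schwartzVec ψ) (schwartzVec (D' φ))) →
      ∀ ψ φ, inner ℂ (schwartzVec ((D * D') ψ)) (schwartzVec φ) =
        inner ℂ (schwartzVec ψ) (schwartzVec ((D * D') φ)) := fun {D D'} h ψ φ => by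
    change inner ℂ (schwartzVec (D (D' ψ))) _ = inner ℂ _ (schwartzVec (D (D' φ)))
    rw [h, hswap h]
  obtain ⟨CB, hCB, hB₁⟩ := hleft B hB B' hB' hBB'
  obtain ⟨C₁, hC₁, h₁⟩ := hleft (A * A') (mul_mem hA hA') (A * A') (mul_mem hA hA') (hself hAA')
  obtain ⟨C₂, hC₂, h₂⟩ := hleft (B * B') (mul_mem hB hB') (B * B') (mul_mem hB hB') (hself hBB')
  -- With σ the lift of S to Schwartz functions and primes for formal adjoints, X is A'SB, Y is X†X,
  -- and Z is the bounded block repeated inside powers of Y.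
  let Z : 𝓢(Config N, ℂ) → 𝓢(Config N, ℂ) := fun χ => (A * A') (σ ((B * B') (σ χ)))
  let X : 𝓢(Config N, ℂ) → 𝓢(Config N, ℂ) := fun φ => A' (σ (B φ))
  let Y : 𝓢(Config N, ℂ) → 𝓢(Config N, ℂ) := fun φ => B' (σ (A (X φ)))
  have hXadj : ∀ φ χ, inner ℂ (schwartzVec (X φ)) (schwartzVec χ) =
      inner ℂ (schwartzVec φ) (schwartzVec (B' (σ (A χ)))) := fun φ χ => by
    rw [hswap hAA', hσ, hsym, ← hBB', hσ]
  have hY : ∀ φ χ, inner ℂ (schwartzVec (Y φ)) (schwartzVec χ) =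
      inner ℂ (schwartzVec φ) (schwartzVec (Y χ)) := fun φ χ => by
    rw [← hXadj φ (X χ), ← inner_conj_symm (schwartzVec (X φ)), hXadj χ (X φ), inner_conj_symm]
  have hZ : ∀ χ n, ‖schwartzVec (Z^[n] χ)‖ ≤ (C₁ * C₂) ^ n * ‖schwartzVec χ‖ := by
    intro χ n
    induction n with
    | zero => simp
    | succ n ih =>
      rw [Function.iterate_succ_apply']
      calc _ ≤ C₁ * (C₂ * ‖schwartzVec (Z^[n] χ)‖) := (h₁ _).trans (by gcongr; exact h₂ _)
        _ ≤ C₁ * (C₂ * ((C₁ * C₂) ^ n * ‖schwartzVec χ‖)) := by gcongr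
        _ = _ := by ring
  have hYn : ∀ φ n, Y^[n + 1] φ = B' (σ (Z^[n] ((A * A') (σ (B φ))))) := by
    intro φ n
    induction n with
    | zero => rfl
    | succ n ih => rw [Function.iterate_succ_apply', ih, Function.iterate_succ_apply' Z]; rfl
  have hYb : ∀ φ, ‖schwartzVec (Y φ)‖ ≤ (C₁ * C₂) * ‖schwartzVec φ‖ := fun φ => by
    -- K involves an a priori uncontrolled norm depending on φ; this is harmless because only the
    -- rate survives.
    refine norm_le_of_inner_iterate (K := CB * ‖schwartzVec ((A * A') (σ (B φ)))‖) hY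
      (by positivity) fun n => ?_
    rw [hYn]
    calc _ ≤ CB * ((C₁ * C₂) ^ n * ‖schwartzVec ((A * A') (σ (B φ)))‖) :=
          (hB₁ _).trans (by gcongr; exact hZ _ n)
      _ = _ := by ring
  have hXb : ∀ φ, ‖schwartzVec (X φ)‖ ≤ Real.sqrt (C₁ * C₂) * ‖schwartzVec φ‖ := fun φ => by
    have h := norm_inner_le_norm (𝕜 := ℂ) (schwartzVec φ) (schwartzVec (Y φ))
    have h' : inner ℂ (schwartzVec (X φ)) (schwartzVec (X φ)) =
      inner ℂ (schwartzVec φ) (schwartzVec (Y φ)) := hXadj φ (X φ)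
    rw [← h', inner_self_eq_norm_sq_to_K] at h
    have h2 : ‖schwartzVec (X φ)‖ ^ 2 ≤ ‖schwartzVec φ‖ * ‖schwartzVec (Y φ)‖ := by
      simpa using h
    refine abs_le_of_sq_le_sq' ?_ (by positivity) |>.2
    rw [mul_pow, Real.sq_sqrt (by positivity)]
    calc _ ≤ ‖schwartzVec φ‖ * (C₁ * C₂ * ‖schwartzVec φ‖) :=
          h2.trans (by gcongr; exact hYb φ)
      _ = _ := by ring
  refine ⟨Real.sqrt (C₁ * C₂), Real.sqrt_nonneg _, fun ψ φ => ?_⟩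
  rw [← hσ, hAA']
  refine (norm_inner_le_norm _ _).trans ?_
  calc _ ≤ ‖schwartzVec ψ‖ * (Real.sqrt (C₁ * C₂) * ‖schwartzVec φ‖) := by
        gcongr; exact hXb φ
    _ = _ := by ring

theorem isSchwartzOperator_opSqrt {T : PosHilbert N →L[ℂ] PosHilbert N} (hT : T.IsPositive)
    (h : IsSchwartzOperator T) : IsSchwartzOperator (opSqrt T) := by
  obtain ⟨hpos, hsq⟩ := opSqrt_spec hT
  have hsa : (opSqrt T).adjoint = opSqrt T := hpos.isSelfAdjoint.adjoint_eq
  refine isSchwartzOperator_iff.2 fun A hA B hB => RightBounded.formBounded hsa ?_ hA hB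
  intro A hA
  obtain ⟨C, hC, hb⟩ := isSchwartzOperator_iff.1 h A hA A hA
  refine ⟨Real.sqrt C, Real.sqrt_nonneg _, fun φ => ?_⟩
  have h1 : inner ℂ (opSqrt T (schwartzVec (A φ))) (opSqrt T (schwartzVec (A φ))) =
      inner ℂ (schwartzVec (A φ)) (T (schwartzVec (A φ))) := by
    rw [← ContinuousLinearMap.adjoint_inner_right, hsa]
    conv_rhs => rw [← hsq]
    rfl
  have h2 := hb φ φ
  rw [← h1, inner_self_eq_norm_sq_to_K] at h2
  refine abs_le_of_sq_le_sq' ?_ (by positivity) |>.2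
  rw [mul_pow, Real.sq_sqrt hC]
  calc _ ≤ C * ‖schwartzVec φ‖ * ‖schwartzVec φ‖ := by simpa using h2
    _ = _ := by ring

/-- The form is ⟨T Aψ, T Bφ⟩, so bounds on T A and T B suffice. -/
theorem isSchwartzOperator_adjoint_mul_self {T : PosHilbert N →L[ℂ] PosHilbert N}
    (h : IsSchwartzOperator T) : IsSchwartzOperator (T.adjoint * T) := by
  refine isSchwartzOperator_iff.2 fun A hA B hB => ?_
  obtain ⟨C, hC, h1⟩ := h.rightBounded A hA
  obtain ⟨D, hD, h2⟩ := h.rightBounded B hB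
  refine ⟨C * D, by positivity, fun ψ φ => ?_⟩
  change ‖inner ℂ _ (T.adjoint (T _))‖ ≤ _
  rw [ContinuousLinearMap.adjoint_inner_right]
  refine (norm_inner_le_norm _ _).trans ?_
  calc _ ≤ (C * ‖schwartzVec ψ‖) * (D * ‖schwartzVec φ‖) := by
        gcongr
        · exact h1 ψ
        · exact h2 φ
    _ = _ := by ring

theorem isPositive_adjoint_mul_self (T : PosHilbert N →L[ℂ] PosHilbert N) :
    (T.adjoint * T).IsPositive := T.isPositive_adjoint_comp_self

theorem isSchwartzOperator_opAbs {T : PosHilbert N →L[ℂ] PosHilbert N}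
    (h : IsSchwartzOperator T) : IsSchwartzOperator (opAbs T) :=
  isSchwartzOperator_opSqrt (isPositive_adjoint_mul_self T) (isSchwartzOperator_adjoint_mul_self h)

end

/-! ### Schwartz operators are Hilbert–Schmidt. -/

noncomputable section

/-- Uniform boundedness of `∑ ‖T e_i‖²` over finite orthonormal families. -/
def HilbertSchmidtBounded {H : Type*} [NormedAddCommGroup H] [InnerProductSpace ℂ H]
    (T : H →L[ℂ] H) : Prop :=
  ∃ C : ℝ, ∀ (ι : Type) [Fintype ι] (e : ι → H), Orthonormal ℂ e → ∑ i, ‖T (e i)‖ ^ 2 ≤ C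

variable {N : ℕ}

/-- The weight `(1 + |q|²)^{-(N + 1)}`, a square-integrable function on `ℝ^N`. -/
def decayWeight (q : Config N) : ℝ := (1 + ‖q‖ ^ 2 : ℝ) ^ (-((N : ℝ) + 1))

theorem decayWeight_pos (q : Config N) : 0 < decayWeight q := by
  unfold decayWeight; positivity

theorem memLp_decayWeight : MemLp (decayWeight (N := N)) 2 volume := memLp_weight N

theorem continuous_decayWeight : Continuous (decayWeight (N := N)) :=
  Continuous.rpow_const (by fun_prop) fun q => Or.inl (by positivity)

theorem decayWeight_hasTemperateGrowth :
    (fun q : Config N => (decayWeight q : ℂ)).HasTemperateGrowth := by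
  unfold decayWeight
  fun_prop

/-- Multiplication by the decaying weight. -/
def decayOp : 𝓢(Config N, ℂ) →L[ℂ] 𝓢(Config N, ℂ) :=
  SchwartzMap.smulLeftCLM ℂ fun q => (decayWeight q : ℂ)

theorem decayOp_apply (φ : 𝓢(Config N, ℂ)) (q : Config N) :
    decayOp φ q = (decayWeight q : ℂ) * φ q := by
  rw [decayOp, SchwartzMap.smulLeftCLM_apply_apply decayWeight_hasTemperateGrowth, smul_eq_mul]

theorem exists_mem_leftInverse_decayOp :
    ∃ A ∈ phaseAlgebra N, ∀ φ, A (decayOp φ) = φ := by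
  let L : 𝓢(Config N, ℂ) →L[ℂ] 𝓢(Config N, ℂ) := 1 + ∑ i, posOp i * posOp i
  have hL : L ∈ phaseAlgebra N :=
    add_mem (one_mem _) (sum_mem fun i _ => mul_mem (posOp_mem i) (posOp_mem i))
  have happ : ∀ φ q, L φ q = ((1 + ‖q‖ ^ 2 : ℝ) : ℂ) * φ q := by
    intro φ q
    have h1 : L φ = φ + ∑ i, posOp i (posOp i φ) := by
      simp only [L, _root_.add_apply, _root_.sum_apply]
      rfl
    have h2 : (∑ i, posOp i (posOp i φ)) q = ∑ i, posOp i (posOp i φ) q := by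
      simp
    rw [h1, _root_.add_apply, h2, EuclideanSpace.norm_sq_eq]
    push_cast
    rw [add_mul, one_mul, Finset.sum_mul]
    congr 1
    refine Finset.sum_congr rfl fun i _ => ?_
    rw [posOp_apply, posOp_apply, Real.norm_eq_abs, ← Complex.ofReal_pow, sq_abs]
    push_cast; ring
  have hpow : ∀ (m : ℕ) φ q, (L ^ m) φ q = (((1 + ‖q‖ ^ 2) ^ m : ℝ) : ℂ) * φ q := by
    intro m
    induction m with
    | zero => intro φ q; simp
    | succ m ih =>
      intro φ q
      rw [pow_succ]
      change (L ^ m) (L φ) q = _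
      rw [ih, happ]
      push_cast; ring
  refine ⟨L ^ (N + 1), pow_mem hL _, fun φ => ?_⟩
  ext q
  have h1 : (0 : ℝ) < 1 + ‖q‖ ^ 2 := by positivity
  have h2 : (1 + ‖q‖ ^ 2) ^ (N + 1) * decayWeight q = 1 := by
    rw [decayWeight, ← Real.rpow_natCast (1 + ‖q‖ ^ 2), ← Real.rpow_add h1]
    simp
  rw [hpow, decayOp_apply, ← mul_assoc, ← Complex.ofReal_mul, h2, Complex.ofReal_one, one_mul]

theorem norm_schwartzVec_fourier (φ : 𝓢(Config N, ℂ)) :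
    ‖schwartzVec (𝓕 φ)‖ = ‖schwartzVec φ‖ := SchwartzMap.norm_fourier_toL2_eq φ

/-- Multiplication by the weight is inverted by some A in the algebra, so ψ = A 𝓕⁻ A (w 𝓕 w ψ).
Moving 𝓕⁻ past the inner A leaves T applied to an algebra element, which is bounded. -/
theorem RightBounded.exists_norm_le {T : PosHilbert N →L[ℂ] PosHilbert N} (hT : RightBounded T) :
    ∃ C, 0 ≤ C ∧ ∀ ψ, ‖T (schwartzVec ψ)‖ ≤ C * ‖schwartzVec (decayOp (𝓕 (decayOp ψ)))‖ := by
  obtain ⟨A, hA, hAW⟩ := exists_mem_leftInverse_decayOp (N := N)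
  obtain ⟨B, hB, hBA⟩ := exists_fourierInv_conj hA
  obtain ⟨C, hC, h⟩ := hT (A * B) (mul_mem hA hB)
  refine ⟨C, hC, fun ψ => ?_⟩
  have h1 : A (B (𝓕⁻ (decayOp (𝓕 (decayOp ψ))))) = ψ := by
    rw [← hBA, hAW, FourierTransform.fourierInv_fourier_eq, hAW]
  have h2 := h (𝓕⁻ (decayOp (𝓕 (decayOp ψ))))
  rw [← norm_schwartzVec_fourier, FourierTransform.fourier_fourierInv_eq] at h2
  change ‖T (schwartzVec (A (B _)))‖ ≤ _ at h2
  rwa [h1] at h2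

/-- The vector `q ↦ e^{2πi⟨q, ξ⟩} (1 + |q|²)^{-(N + 1)}`. -/
def weightedWave (ξ : Config N) : PosHilbert N :=
  MemLp.toLp (fun q => (Real.fourierChar (inner ℝ q ξ) : ℂ) * (decayWeight q : ℂ))
    (memLp_decayWeight.ofReal.of_le (g := fun q => (decayWeight q : ℂ))
      (Continuous.aestronglyMeasurable (by
        have := continuous_decayWeight (N := N)
        have := Real.continuous_fourierChar
        fun_prop)) (Filter.Eventually.of_forall fun q => by
        rw [norm_mul, Circle.norm_coe, one_mul]))

theorem weightedWave_coeFn (ξ : Config N) : weightedWave ξ =ᵐ[volume]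
    fun q => (Real.fourierChar (inner ℝ q ξ) : ℂ) * (decayWeight q : ℂ) :=
  MemLp.coeFn_toLp _

theorem norm_weightedWave (ξ : Config N) : ‖weightedWave ξ‖ = ‖weightedWave (0 : Config N)‖ := by
  refine le_antisymm ?_ ?_ <;>
  · refine Lp.norm_le_norm_of_ae_le ?_
    filter_upwards [weightedWave_coeFn ξ, weightedWave_coeFn (0 : Config N)] with q h1 h2
    rw [h1, h2, norm_mul, norm_mul, Circle.norm_coe, Circle.norm_coe]

theorem inner_weightedWave (ξ : Config N) (u : PosHilbert N) :
    inner ℂ (weightedWave ξ) u = 𝓕 (fun q => (decayWeight q : ℂ) * u q) ξ := by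
  rw [L2.inner_def, Real.fourier_eq]
  refine integral_congr_ae ?_
  filter_upwards [weightedWave_coeFn ξ] with q hq
  rw [hq, RCLike.inner_apply, map_mul, Complex.conj_ofReal, AddChar.map_neg_eq_inv,
    Circle.smul_def, Circle.coe_inv_eq_conj, smul_eq_mul]
  ring

theorem continuous_inner_weightedWave (u : PosHilbert N) :
    Continuous fun ξ : Config N => inner ℂ (weightedWave ξ) u := by
  simp only [inner_weightedWave]
  exact VectorFourier.fourierIntegral_continuous Real.continuous_fourierChar
    (by exact continuous_inner) ((memLp_decayWeight.ofReal (K := ℂ)).integrable_mul (Lp.memLp u))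

theorem norm_decayOp_fourier_decayOp_sq (ψ : 𝓢(Config N, ℂ)) :
    ‖schwartzVec (decayOp (𝓕 (decayOp ψ)))‖ ^ 2 =
      ∫ ξ : Config N, decayWeight ξ ^ 2 * ‖inner ℂ (weightedWave ξ) (schwartzVec ψ)‖ ^ 2 := by
  have h : ∀ ξ : Config N, inner ℂ (weightedWave ξ) (schwartzVec ψ) = 𝓕 (decayOp ψ) ξ := by
    intro ξ
    rw [inner_weightedWave, SchwartzMap.fourier_coe, Real.fourier_eq, Real.fourier_eq]
    refine integral_congr_ae ?_
    filter_upwards [SchwartzMap.coeFn_toLp ψ 2 volume] with q hq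
    rw [schwartzVec, hq, decayOp_apply]
  have h2 : ((‖schwartzVec (decayOp (𝓕 (decayOp ψ)))‖ ^ 2 : ℝ) : ℂ) =
      ((∫ ξ : Config N, decayWeight ξ ^ 2 * ‖inner ℂ (weightedWave ξ) (schwartzVec ψ)‖ ^ 2 : ℝ) :
        ℂ) := by
    have h3 := inner_self_eq_norm_sq_to_K (𝕜 := ℂ) (schwartzVec (decayOp (𝓕 (decayOp ψ))))
    rw [inner_schwartzVec] at h3
    rw [← integral_complex_ofReal]
    push_cast
    refine h3.symm.trans ?_
    congr 1; ext ξ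
    rw [h, inner_self_eq_norm_sq_to_K, decayOp_apply, norm_mul, Complex.norm_real,
      Real.norm_eq_abs, abs_of_pos (decayWeight_pos ξ)]
    simp only [RCLike.ofReal_eq_complex_ofReal]
    push_cast; ring
  exact_mod_cast h2

theorem integrable_decayWeight_sq_mul (u : PosHilbert N) :
    Integrable fun ξ : Config N => decayWeight ξ ^ 2 * ‖inner ℂ (weightedWave ξ) u‖ ^ 2 := by
  have hc := continuous_inner_weightedWave u
  have hd := continuous_decayWeight (N := N)
  refine ((memLp_decayWeight (N := N)).integrable_sq.mul_const
    ((‖weightedWave (0 : Config N)‖ * ‖u‖) ^ 2)).mono'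
    (Continuous.aestronglyMeasurable (by fun_prop)) (Filter.Eventually.of_forall fun ξ => ?_)
  rw [Real.norm_eq_abs, abs_of_nonneg (by positivity)]
  gcongr
  exact (norm_inner_le_norm _ _).trans_eq (by rw [norm_weightedWave])

/-- Density and dominated convergence extend the estimate from Schwartz functions to L², as needed
for arbitrary orthonormal families. -/
theorem RightBounded.exists_norm_sq_le {T : PosHilbert N →L[ℂ] PosHilbert N}
    (hT : RightBounded T) : ∃ C, 0 ≤ C ∧ ∀ u, ‖T u‖ ^ 2 ≤
      C * ∫ ξ : Config N, decayWeight ξ ^ 2 * ‖inner ℂ (weightedWave ξ) u‖ ^ 2 := by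
  obtain ⟨C, hC, h⟩ := hT.exists_norm_le
  refine ⟨C ^ 2, by positivity, fun u => ?_⟩
  obtain ⟨x, hx, hlim⟩ := mem_closure_iff_seq_limit.1 (denseRange_schwartzVec u)
  choose ψ hψ using hx
  obtain ⟨R, hR⟩ := hlim.norm.bddAbove_range
  have hR' : ∀ n, ‖x n‖ ≤ R := fun n => hR ⟨n, rfl⟩
  have hd := continuous_decayWeight (N := N)
  have hint : Filter.Tendsto
      (fun n => ∫ ξ : Config N, decayWeight ξ ^ 2 * ‖inner ℂ (weightedWave ξ) (x n)‖ ^ 2)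
      Filter.atTop
      (nhds (∫ ξ : Config N, decayWeight ξ ^ 2 * ‖inner ℂ (weightedWave ξ) u‖ ^ 2)) := by
    refine tendsto_integral_of_dominated_convergence
      (fun ξ => decayWeight ξ ^ 2 * (‖weightedWave (0 : Config N)‖ * R) ^ 2) (fun n => ?_)
      (memLp_decayWeight.integrable_sq.mul_const _) (fun n => ?_) ?_
    · exact (integrable_decayWeight_sq_mul (x n)).aestronglyMeasurable
    · refine Filter.Eventually.of_forall fun ξ => ?_
      rw [Real.norm_eq_abs, abs_of_nonneg (by positivity)]
      gcongr
      refine (norm_inner_le_norm _ _).trans ?_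
      rw [norm_weightedWave]
      gcongr
      exact hR' n
    · refine Filter.Eventually.of_forall fun ξ => ?_
      exact (((tendsto_const_nhds (x := weightedWave ξ)).inner hlim).norm.pow 2).const_mul _
  refine le_of_tendsto_of_tendsto' (((T.continuous.tendsto u).comp hlim).norm.pow 2)
    (hint.const_mul _) fun n => ?_
  rw [Function.comp_apply, ← hψ, ← norm_decayOp_fourier_decayOp_sq, ← mul_pow]
  gcongr
  exact h (ψ n)

/-- Bessel's inequality for the weighted wave at each ξ, whose norm does not depend on ξ, is
integrated against the squared weight. -/
theorem RightBounded.hilbertSchmidtBounded {T : PosHilbert N →L[ℂ] PosHilbert N}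
    (hT : RightBounded T) : HilbertSchmidtBounded T := by
  obtain ⟨C, hC, h⟩ := hT.exists_norm_sq_le
  refine ⟨C * ∫ ξ : Config N, decayWeight ξ ^ 2 * ‖weightedWave (0 : Config N)‖ ^ 2,
    fun ι _ e he => ?_⟩
  refine (Finset.sum_le_sum fun i _ => h (e i)).trans ?_
  rw [← Finset.mul_sum, ← integral_finsetSum _ fun i _ => integrable_decayWeight_sq_mul (e i)]
  refine mul_le_mul_of_nonneg_left (integral_mono ?_ ?_ fun ξ => ?_) hC
  · exact integrable_finsetSum _ fun i _ => integrable_decayWeight_sq_mul (e i)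
  · exact memLp_decayWeight.integrable_sq.mul_const _
  · simp only [← Finset.mul_sum]
    gcongr
    rw [← norm_weightedWave ξ]
    refine le_trans (le_of_eq ?_) (he.sum_inner_products_le (weightedWave ξ) (s := Finset.univ))
    exact Finset.sum_congr rfl fun i _ => by rw [norm_inner_symm]

end

/-! ### Compactness and summability of singular values. -/

noncomputable section

section HilbertSpace

variable {H : Type*} [NormedAddCommGroup H] [InnerProductSpace ℂ H]

theorem HilbertSchmidtBounded.exists_finiteDimensional {T : H →L[ℂ] H}
    (hT : HilbertSchmidtBounded T) {ε : ℝ} (hε : 0 < ε) :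
    ∃ U : Submodule ℂ H, FiniteDimensional ℂ U ∧ ∀ x ∈ Uᗮ, ‖T x‖ ≤ ε * ‖x‖ := by
  obtain ⟨C, hC⟩ := hT
  let V : Set ℝ := {r | ∃ (n : ℕ) (e : Fin n → H), Orthonormal ℂ e ∧ r = ∑ i, ‖T (e i)‖ ^ 2}
  have hbdd : BddAbove V := ⟨C, by rintro _ ⟨n, e, he, rfl⟩; exact hC (Fin n) e he⟩
  have h0 : Orthonormal ℂ (Fin.elim0 : Fin 0 → H) := ⟨fun i => i.elim0, fun i => i.elim0⟩
  have hne : V.Nonempty := ⟨∑ i : Fin 0, ‖T ((Fin.elim0 : Fin 0 → H) i)‖ ^ 2, 0, _, h0, rfl⟩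
  obtain ⟨_, ⟨n, e, he, rfl⟩, hlt⟩ := exists_lt_of_lt_csSup hne
    (sub_lt_self (sSup V) (pow_pos hε 2))
  refine ⟨Submodule.span ℂ (Set.range e), FiniteDimensional.span_of_finite ℂ (Set.finite_range e),
    fun x hx => ?_⟩
  have hunit : ∀ y ∈ (Submodule.span ℂ (Set.range e))ᗮ, ‖y‖ = 1 → ‖T y‖ ≤ ε := by
    intro y hy hy1
    have hon : Orthonormal ℂ (Matrix.vecCons y e) := by
      rw [orthonormal_vecCons_iff]
      exact ⟨hy1, fun i => Submodule.inner_left_of_mem_orthogonal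
        (Submodule.subset_span (Set.mem_range_self i)) hy, he⟩
    -- The family e comes within ε² of the supremum, so adjoining y can add at most ε².
    have h := le_csSup hbdd ⟨n + 1, Matrix.vecCons y e, hon, rfl⟩
    rw [Fin.sum_univ_succ] at h
    simp only [Matrix.cons_val_zero, Matrix.cons_val_succ] at h
    refine abs_le_of_sq_le_sq' ?_ hε.le |>.2
    linarith
  by_cases hx0 : ‖x‖ = 0
  · rw [norm_eq_zero.1 hx0]; simp
  have hx' : 0 < ‖x‖ := lt_of_le_of_ne (norm_nonneg _) (Ne.symm hx0)
  have := hunit (((‖x‖⁻¹ : ℝ) : ℂ) • x) (Submodule.smul_mem _ _ hx) (by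
    rw [norm_smul, Complex.norm_real, norm_inv, norm_norm, inv_mul_cancel₀ hx0])
  rw [map_smul, norm_smul, Complex.norm_real, norm_inv, norm_norm, inv_mul_le_iff₀ hx'] at this
  rwa [mul_comm]

variable [CompleteSpace H]

theorem HilbertSchmidtBounded.isCompactOperator {T : H →L[ℂ] H}
    (hT : HilbertSchmidtBounded T) : IsCompactOperator T := by
  have hcl := isClosed_setOfPred_isCompactOperator (𝕜₁ := ℂ) (𝕜₂ := ℂ) (σ₁₂ := RingHom.id ℂ)
    (M₁ := H) (M₂ := H)
  have hmem : T ∈ closure {f : H →L[ℂ] H | IsCompactOperator f} := by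
    rw [Metric.mem_closure_iff]
    intro ε hε
    obtain ⟨U, hU, h⟩ := hT.exists_finiteDimensional (half_pos hε)
    refine ⟨T ∘L U.starProjection, ?_, ?_⟩
    · have : LocallyCompactSpace U := by
        have := FiniteDimensional.proper ℂ U
        infer_instance
      have h1 : IsCompactOperator (U.orthogonalProjectionOnto : H → U) :=
        isCompactOperator_of_locallyCompactSpace_dom U.orthogonalProjectionOnto
      exact h1.clm_comp (T ∘L U.subtypeL)
    · rw [dist_eq_norm]
      refine lt_of_le_of_lt (ContinuousLinearMap.opNorm_le_bound _ (half_pos hε).le fun x => ?_)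
        (half_lt_self hε)
      have h2 : (T - T ∘L U.starProjection) x = T (x - U.starProjection x) := by simp
      rw [h2]
      refine (h _ (Submodule.sub_starProjection_mem_orthogonal x)).trans ?_
      gcongr
      have h3 : x - U.starProjection x = Uᗮ.starProjection x := by
        rw [Submodule.starProjection_orthogonal]; rfl
      rw [h3]
      exact Submodule.norm_starProjection_apply_le _ x
  rwa [hcl.closure_eq] at hmem

/-- With s = √c, the vector y = √W x - s x satisfies √W y = -s y, which positivity of √W allows only
for y = 0. -/
theorem opSqrt_apply_eigenvector {W : H →L[ℂ] H} (hW : W.IsPositive) {c : ℝ} (hc : 0 < c) {x : H}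
    (hx : W x = (c : ℂ) • x) : opSqrt W x = ((c ^ (1 / 2 : ℝ) : ℝ) : ℂ) • x := by
  obtain ⟨hpos, hsq⟩ := opSqrt_spec hW
  set s : ℝ := c ^ (1 / 2 : ℝ)
  have hs : 0 < s := Real.rpow_pos_of_pos hc _
  have hss : (s : ℂ) * s = c := by
    rw [← Complex.ofReal_mul, ← Real.rpow_add hc]
    norm_num
  set y := opSqrt W x - (s : ℂ) • x with hy
  have h1 : opSqrt W y = -((s : ℂ) • y) := by
    have h2 : opSqrt W (opSqrt W x) = W x :=
      congrArg (fun A : H →L[ℂ] H => A x) hsq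
    rw [hy, map_sub, h2, map_smul, hx, ← hss, mul_smul, smul_sub]
    abel
  have h3 := hpos.re_inner_nonneg_left y
  rw [h1, inner_neg_left, inner_smul_left, Complex.conj_ofReal, inner_self_eq_norm_sq_to_K] at h3
  have h4 : s * ‖y‖ ^ 2 ≤ 0 := by
    have : (RCLike.re (-((s : ℂ) * ((‖y‖ : ℝ) : ℂ) ^ 2)) : ℝ) = -(s * ‖y‖ ^ 2) := by
      rw [← Complex.ofReal_pow, ← Complex.ofReal_mul, ← Complex.ofReal_neg]
      exact Complex.ofReal_re _
    erw [this] at h3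
    linarith
  have h5 : ‖y‖ ^ 2 ≤ 0 := by
    by_contra! h
    exact absurd h4 (not_le.2 (mul_pos hs h))
  have h6 : y = 0 := by
    rw [← norm_eq_zero]
    exact pow_eq_zero_iff two_ne_zero |>.1 (le_antisymm h5 (sq_nonneg _))
  exact sub_eq_zero.1 h6

theorem isPositive_opAbs (T : H →L[ℂ] H) : (opAbs T).IsPositive :=
  (opSqrt_spec T.isPositive_adjoint_comp_self).1

open Classical in
/-- Orthonormal eigenvectors of `|T|` belonging to the singular values of `T`. -/
def singularVector (T : H →L[ℂ] H) (k : SingularIndex T) : H :=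
  if _h : FiniteDimensional ℂ (absEigenspace T k.1) then
    (stdOrthonormalBasis ℂ (absEigenspace T k.1) k.2 : absEigenspace T k.1)
  -- Never reached: in infinite dimension `finrank` is 0, so there is no index.
  else 0

theorem opAbs_singularVector (T : H →L[ℂ] H) (k : SingularIndex T) :
    opAbs T (singularVector T k) = (singularValue T k : ℂ) • singularVector T k := by
  unfold singularVector
  split_ifs with h
  · exact Module.End.mem_eigenspace_iff.1
      (stdOrthonormalBasis ℂ (absEigenspace T k.1) k.2).2
  · simp

theorem orthonormal_singularVector {T : H →L[ℂ] H}
    (hT : ∀ c : ℝ, 0 < c → FiniteDimensional ℂ (absEigenspace T c)) :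
    Orthonormal ℂ (singularVector T) := by
  have hfd : ∀ c : {c : ℝ // 0 < c}, FiniteDimensional ℂ (absEigenspace T c) :=
    fun c => hT c c.2
  have hfam : OrthogonalFamily ℂ (fun c : {c : ℝ // 0 < c} => absEigenspace T c)
      fun c => (absEigenspace T c).subtypeₗᵢ :=
    ((isPositive_opAbs T).isSymmetric.orthogonalFamily_eigenspaces).comp
      (f := fun c : {c : ℝ // 0 < c} => ((c : ℝ) : ℂ))
      fun a b h => Subtype.ext (Complex.ofReal_injective h)
  have h := hfam.orthonormal_sigma_orthonormal
    (v_family := fun c => stdOrthonormalBasis ℂ (absEigenspace T c))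
    fun c => (stdOrthonormalBasis ℂ (absEigenspace T c)).orthonormal
  have heq : singularVector T = fun k : SingularIndex T => (absEigenspace T k.1).subtypeₗᵢ
      (stdOrthonormalBasis ℂ (absEigenspace T k.1) k.2) :=
    funext fun k => dif_pos (hfd k.1)
  rw [heq]
  exact h

end HilbertSpace

variable {N : ℕ}

theorem IsSchwartzOperator.hilbertSchmidtBounded {T : PosHilbert N →L[ℂ] PosHilbert N}
    (hT : IsSchwartzOperator T) : HilbertSchmidtBounded T :=
  hT.rightBounded.hilbertSchmidtBounded

theorem IsSchwartzOperator.finiteDimensional_absEigenspace {T : PosHilbert N →L[ℂ] PosHilbert N}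
    (hT : IsSchwartzOperator T) {c : ℝ} (hc : 0 < c) :
    FiniteDimensional ℂ (absEigenspace T c) :=
  ContinuousLinearMap.finite_dimensional_eigenspace
    (isSchwartzOperator_opAbs hT).hilbertSchmidtBounded.isCompactOperator (c : ℂ)
    (Complex.ofReal_ne_zero.2 hc.ne')

theorem IsSchwartzOperator.exists_root {W : PosHilbert N →L[ℂ] PosHilbert N}
    (hW : W.IsPositive) (h : IsSchwartzOperator W) (m : ℕ) :
    ∃ R : PosHilbert N →L[ℂ] PosHilbert N, R.IsPositive ∧ IsSchwartzOperator R ∧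
      ∀ (c : ℝ) (x : PosHilbert N), 0 < c → W x = (c : ℂ) • x →
        R x = ((c ^ ((1 / 2 : ℝ) ^ m) : ℝ) : ℂ) • x := by
  induction m with
  | zero => exact ⟨W, hW, h, fun c x _ hx => by simpa using hx⟩
  | succ m ih =>
    obtain ⟨R, hR, hRS, hRx⟩ := ih
    refine ⟨opSqrt R, (opSqrt_spec hR).1, isSchwartzOperator_opSqrt hR hRS, fun c x hc hx => ?_⟩
    rw [opSqrt_apply_eigenvector hR (Real.rpow_pos_of_pos hc _) (hRx c x hc hx),
      ← Real.rpow_mul hc.le, pow_succ]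

theorem IsSchwartzOperator.summable_singularValue {T : PosHilbert N →L[ℂ] PosHilbert N}
    (hT : IsSchwartzOperator T) {p : ℝ} (hp : 0 < p) :
    Summable fun k : SingularIndex T => singularValue T k ^ p := by
  -- The choice gives 2·2^-m < p; the surplus exponent is absorbed by the bound of the singular
  -- values by the norm of |T|.
  obtain ⟨m, hm⟩ := exists_pow_lt_of_lt_one (half_pos hp) (by norm_num : (1 / 2 : ℝ) < 1)
  obtain ⟨R, -, hRS, hR⟩ := (isSchwartzOperator_opAbs hT).exists_root (isPositive_opAbs T) m
  obtain ⟨C, hC⟩ := hRS.hilbertSchmidtBounded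
  have hon := orthonormal_singularVector (T := T) fun c hc => hT.finiteDimensional_absEigenspace hc
  have hpos : ∀ k : SingularIndex T, 0 < singularValue T k := fun k => k.1.2
  have hle : ∀ k : SingularIndex T, singularValue T k ≤ ‖opAbs T‖ := fun k => by
    have h := (opAbs T).le_opNorm (singularVector T k)
    rw [opAbs_singularVector, norm_smul, hon.1 k, Complex.norm_real, Real.norm_eq_abs,
      abs_of_pos (hpos k)] at h
    simpa using h
  have hsq : ∀ k : SingularIndex T, ‖R (singularVector T k)‖ ^ 2 =
      singularValue T k ^ (2 * (1 / 2 : ℝ) ^ m) := fun k => by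
    rw [hR _ _ (hpos k) (opAbs_singularVector T k), norm_smul, hon.1 k, Complex.norm_real,
      Real.norm_eq_abs, abs_of_pos (Real.rpow_pos_of_pos (hpos k) _), mul_one,
      ← Real.rpow_mul_natCast (hpos k).le, mul_comm]
    norm_num
  have hsum : Summable fun k : SingularIndex T => ‖R (singularVector T k)‖ ^ 2 := by
    refine summable_of_sum_le (c := C) (fun k => by positivity) fun s => ?_
    rw [← Finset.sum_coe_sort]
    exact hC s _ (hon.comp _ Subtype.val_injective)
  refine Summable.of_nonneg_of_le (fun k => (Real.rpow_pos_of_pos (hpos k) _).le) (fun k => ?_)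
    (hsum.mul_right (‖opAbs T‖ ^ (p - 2 * (1 / 2 : ℝ) ^ m)))
  rw [hsq]
  calc singularValue T k ^ p
      = singularValue T k ^ (2 * (1 / 2 : ℝ) ^ m) *
          singularValue T k ^ (p - 2 * (1 / 2 : ℝ) ^ m) := by
        rw [← Real.rpow_add (hpos k)]; ring_nf
    _ ≤ _ := by
        have := hpos k
        have := hle k
        gcongr
        linarith

end

theorem mainTheorem5 (N : ℕ) :
    (∀ T : PosHilbert N →L[ℂ] PosHilbert N, T.IsPositive → IsSchwartzOperator T →
      IsSchwartzOperator (opSqrt T)) ∧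
    (∀ T : PosHilbert N →L[ℂ] PosHilbert N, IsSchwartzOperator T →
      IsSchwartzOperator (opAbs T) ∧
      IsCompactOperator T ∧
      (∀ c : ℝ, 0 < c → FiniteDimensional ℂ (absEigenspace T c)) ∧
      ∀ n : ℕ, 1 ≤ n →
        Summable fun k : SingularIndex T => singularValue T k ^ (1 / (2 * (n : ℝ)))) := by
  refine ⟨fun T hT h => isSchwartzOperator_opSqrt hT h, fun T hT =>
    ⟨isSchwartzOperator_opAbs hT, hT.hilbertSchmidtBounded.isCompactOperator,
      fun c hc => hT.finiteDimensional_absEigenspace hc, fun n hn => ?_⟩⟩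
  have hn' : (0 : ℝ) < n := Nat.cast_pos.2 hn
  exact hT.summable_singularValue (by positivity)
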